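/- Let $p$ be an odd prime and let $T$ be the regular $p$-adic rooted tree, whose vertices are the finite words over the alphabet $X=\{1,\ldots,p\}$, the empty word being the root and the children of a word $u$ being the words $ux$ with $x\in X$. For an automorphism $g$ of $T$ fixing all vertices of the first level, write $\psi_1(g)=(g_1,\ldots,g_p)$, where $g_x\in\mathrm{Aut}(T)$ is determined by $g(xw)=x\,g_x(w)$ for all words $w$. Let $a\in\mathrm{Aut}(T)$ be the rooted automorphism that permutes the first letter of every non-empty word by the $p$-cycle $(1\,2\,\ldots\,p)$ and leaves all other letters unchanged. Let $r\ge 1$, and let $\mathbf e_i=(e_{i,1},\ldots,e_{i,p-1})\in(\mathbb Z/p\mathbb Z)^{p-1}$, $i\in\{1,\ldots,r\}$, be linearly independent over $\mathbb Z/p\mathbb Z$. Define recursively automorphisms $b_1,\ldots,b_r$ of $T$, fixing all vertices of the first level, by $$\psi_1(b_i)=(a^{e_{i,1}},\ldots,a^{e_{i,p-1}},b_i),\qquad i\in\{1,\ldots,r\},$$ and let $G=\langle a,b_1,\ldots,b_r\rangle\le\mathrm{Aut}(T)$ be the multi-edge spinal group with defining vectors $\mathbf e_1,\ldots,\mathbf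 e_r$. Suppose that $G$ is torsion, i.e. every element of $G$ has finite order. Then every maximal subgroup of $G$ is normal of index $p$. In particular, $G$ has no maximal subgroups of infinite index. -/

import Mathlib

namespace MultiEdgeSpinal

/-- The automorphism group of the regular rooted tree whose vertices are the finite words over the
alphabet `X` (the root is the empty word, and the children of `u` are the words `u ++ [x]`): the
bijections of the vertex set that preserve and reflect the relation `u is a prefix of v`. -/
def TreeAut (X : Type*) : Subgroup (Equiv.Perm (List X)) where
  carrier := {f | ∀ u v : List X, f u <+: f v ↔ u <+: v}
  mul_mem' := fun {f g} hf hg u v => (hf (g u) (g v)).trans (hg u v)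
  one_mem' := fun _ _ => Iff.rfl
  inv_mem' := fun {f} hf u v => by
    have h := hf (f⁻¹ u) (f⁻¹ v)
    rw [← Equiv.Perm.mul_apply, ← Equiv.Perm.mul_apply, mul_inv_cancel] at h
    exact h.symm

section Rooted

variable {X : Type*}

/-- `x w ↦ σ(x) w` on nonempty words; the root is fixed. -/
def rootedFun (σ : Equiv.Perm X) : List X → List X
  | [] => []
  | x :: w => σ x :: w

theorem rootedFun_leftInverse (σ : Equiv.Perm X) (u : List X) :
    rootedFun σ⁻¹ (rootedFun σ u) = u := by
  cases u <;> simp [rootedFun]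

/-- The rooted automorphism of the tree corresponding to a permutation `σ` of the first level. -/
def rooted (σ : Equiv.Perm X) : TreeAut X :=
  ⟨{ toFun := rootedFun σ
     invFun := rootedFun σ⁻¹
     left_inv := rootedFun_leftInverse σ
     right_inv := fun u => by simpa using rootedFun_leftInverse σ⁻¹ u },
   fun u v => by
    cases u <;> cases v <;> simp [rootedFun, List.cons_prefix_cons]⟩

end Rooted

section Directed

variable {X : Type*} [DecidableEq X]

/-- The map `b` on words given recursively by `b(o w) = o b(w)` and `b(x w) = x (c x)(w)` for
letters `x ≠ o`; the root is fixed. -/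
def directedFun (o : X) (c : {x : X // x ≠ o} → TreeAut X) : List X → List X
  | [] => []
  | x :: w => if h : x = o then x :: directedFun o c w
      else x :: (c ⟨x, h⟩ : Equiv.Perm (List X)) w

theorem directedFun_leftInverse (o : X) (c : {x : X // x ≠ o} → TreeAut X) (u : List X) :
    directedFun o c⁻¹ (directedFun o c u) = u := by
  induction u with
  | nil => rfl
  | cons x w ih =>
    by_cases h : x = o
    · subst h
      simpa [directedFun] using ih
    · simp [directedFun, h]

theorem directedFun_prefix (o : X) (c : {x : X // x ≠ o} → TreeAut X) (u v : List X) :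
    directedFun o c u <+: directedFun o c v ↔ u <+: v := by
  induction u generalizing v with
  | nil => simp [directedFun]
  | cons x w ih =>
    cases v with
    | nil =>
      by_cases h : x = o
      · simp [directedFun, h]
      · simp [directedFun, h]
    | cons y z =>
      by_cases h : x = o
      · by_cases h' : y = o
        · simp [directedFun, h, h', List.cons_prefix_cons, ih]
        · simp [directedFun, h, h', List.cons_prefix_cons, Ne.symm h']
      · by_cases h' : y = o
        · simp [directedFun, h, h', List.cons_prefix_cons]
        · simp only [directedFun, h, h', dite_false, List.cons_prefix_cons]
          refine and_congr_right fun hxy => ?_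
          subst hxy
          exact (c ⟨x, h⟩).2 w z

/-- The automorphism `b` in the first level stabilizer whose section at the letter `o` is `b`
itself and whose section at each other letter `x` is `c x`. -/
def directed (o : X) (c : {x : X // x ≠ o} → TreeAut X) : TreeAut X :=
  ⟨{ toFun := directedFun o c
     invFun := directedFun o c⁻¹
     left_inv := directedFun_leftInverse o c
     right_inv := fun u => by simpa using directedFun_leftInverse o c⁻¹ u },
   directedFun_prefix o c⟩

end Directed

/-- The rooted automorphism `a` of the `p`-adic tree corresponding to the `p`-cycle
`(1 2 … p)`. The alphabet `{1, …, p}` is identified with `ZMod p`, the letter `p` being `0`. -/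
def genA (p : ℕ) : TreeAut (ZMod p) :=
  rooted (Equiv.addRight 1)

/-- The directed automorphism `b` with `ψ₁(b) = (a ^ e₁, …, a ^ e₍ₚ₋₁₎, b)`; the coordinates of
the vector `e` are indexed by the letters `1, …, p - 1`, that is, by the nonzero elements of
`ZMod p`. -/
def genB (p : ℕ) (e : {x : ZMod p // x ≠ 0} → ZMod p) : TreeAut (ZMod p) :=
  directed 0 fun x => genA p ^ (e x).val

/-- The group `⟨a, b₁, …, bᵣ⟩` of automorphisms of the `p`-adic tree determined by the vectors
`E 0, …, E (r - 1)`. It is the multi-edge spinal group with these defining vectors if `p` is an odd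
prime, `r ≥ 1` and the vectors are linearly independent over `ZMod p`. -/
def multiEdgeSpinalGroup (p : ℕ) {r : ℕ} (E : Fin r → {x : ZMod p // x ≠ 0} → ZMod p) :
    Subgroup (TreeAut (ZMod p)) :=
  Subgroup.closure ({genA p} ∪ Set.range fun i => genB p (E i))

end MultiEdgeSpinal

/-! A torsion spinal group is a `p`-group, so a maximal subgroup of finite index becomes a maximal
subgroup of a finite `p`-group modulo its core; it is normal of index `p`. A maximal subgroup of
infinite index surjects onto every finite quotient, so it suffices that no proper subgroup is dense
in the profinite topology.

Two facts drive this. First, torsion forces the coordinates of every nonzero exponent vector to sum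
to zero, so at least two are nonzero. Commutators of conjugates of directed elements then make the
group weakly regular branch over its derived subgroup `derivedSeries Γ (p - 1)`, and every
nontrivial normal subgroup has finite index (`finiteIndex_of_ne_bot`). From this, sections of a
proper prodense subgroup are again proper and prodense (`isProperProdense_secSubgroup`).

Second, taking sections does not increase the number of directed factors in a word, and strictly
decreases it at every letter unless the element is, up to rooted factors, a single directed element.
Passing repeatedly to sections and conjugates of a proper prodense subgroup therefore yields one
containing a nontrivial directed element, then also all rooted elements, and then ever more directed
elements. Once it contains all generators it is not proper, a contradiction
(`not_isProperProdense`). -/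

open scoped commutatorElement

namespace MultiEdgeSpinal

/-! ### Commutator subgroups of finitely generated torsion groups -/

section GroupLemmas

variable {Γ : Type*} [Group Γ]

theorem finiteIndex_commutator_of_fg_of_isMulTorsion [Group.FG Γ] (ht : IsMulTorsion Γ) :
    (commutator Γ).FiniteIndex := by
  have hfg : Group.FG (Abelianization Γ) :=
    Group.fg_of_surjective (f := (Abelianization.of : Γ →* Abelianization Γ))
      QuotientGroup.mk_surjective
  have htor : IsMulTorsion (Abelianization Γ) := by
    intro g
    obtain ⟨g, rfl⟩ := QuotientGroup.mk_surjective g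
    exact Abelianization.of.isOfFinOrder (ht g)
  have : Finite (Γ ⧸ commutator Γ) := CommGroup.finite_of_fg_isMulTorsion (Abelianization Γ) htor
  exact Subgroup.finiteIndex_of_finite_quotient (H := commutator Γ)

/-- By Schreier, `H` is again finitely generated and torsion, so its abelianization is finite. -/
theorem finiteIndex_commutator_self [Group.FG Γ] (ht : IsMulTorsion Γ) (H : Subgroup Γ)
    [H.FiniteIndex] : (⁅H, H⁆ : Subgroup Γ).FiniteIndex := by
  have := Subgroup.fg_of_index_ne_zero H
  have hH : IsMulTorsion H := fun g => by
    simpa using (Subgroup.subtype_injective H).isOfFinOrder_iff.1 (ht (g : Γ))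
  have := finiteIndex_commutator_of_fg_of_isMulTorsion hH
  refine ⟨?_⟩
  rw [← Subgroup.map_subtype_commutator, Subgroup.index_map_subtype]
  exact mul_ne_zero this.index_ne_zero Subgroup.FiniteIndex.index_ne_zero

theorem finiteIndex_commutator [Group.FG Γ] (ht : IsMulTorsion Γ) (H K : Subgroup Γ)
    [H.FiniteIndex] [K.FiniteIndex] : (⁅H, K⁆ : Subgroup Γ).FiniteIndex :=
  have := finiteIndex_commutator_self ht (H ⊓ K)
  Subgroup.finiteIndex_of_le
    (Subgroup.commutator_mono (inf_le_left : H ⊓ K ≤ H) (inf_le_right : H ⊓ K ≤ K))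

theorem finiteIndex_derivedSeries [Group.FG Γ] (ht : IsMulTorsion Γ) (n : ℕ) :
    (derivedSeries Γ n).FiniteIndex := by
  induction n with
  | zero => rw [derivedSeries_zero]; infer_instance
  | succ n ih => rw [derivedSeries_succ]; exact finiteIndex_commutator_self ht _

theorem commutator_le_of_closure_eq_top {T : Set Γ} (hT : Subgroup.closure T = ⊤)
    (Q : Subgroup Γ) [Q.Normal] (h : ∀ s ∈ T, ∀ t ∈ T, ⁅s, t⁆ ∈ Q) : commutator Γ ≤ Q := by
  have key : ∀ s t : Γ, Commute (s : Γ ⧸ Q) (t : Γ ⧸ Q) := by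
    have base : ∀ s ∈ T, ∀ t ∈ T, Commute (s : Γ ⧸ Q) (t : Γ ⧸ Q) := by
      intro s hs t ht
      rw [← commutatorElement_eq_one_iff_commute]
      exact (QuotientGroup.eq_one_iff _).2 (h s hs t ht)
    have step : ∀ s ∈ T, ∀ t : Γ, Commute (s : Γ ⧸ Q) (t : Γ ⧸ Q) := by
      intro s hs t
      have ht : t ∈ Subgroup.closure T := hT ▸ Subgroup.mem_top t
      induction ht using Subgroup.closure_induction with
      | mem x hx => exact base s hs x hx
      | one => exact Commute.one_right _
      | mul x y _ _ hx hy => exact hx.mul_right hy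
      | inv x _ hx => exact hx.inv_right
    intro s t
    have hs : s ∈ Subgroup.closure T := hT ▸ Subgroup.mem_top s
    induction hs using Subgroup.closure_induction with
    | mem x hx => exact step x hx t
    | one => exact Commute.one_left _
    | mul x y _ _ hx hy => exact hx.mul_left hy
    | inv x _ hx => exact hx.inv_left
  rw [commutator_def, Subgroup.commutator_le]
  intro s _ t _
  have := commutatorElement_eq_one_iff_commute.2 (key s t)
  exact (QuotientGroup.eq_one_iff _).1 this

/-- A subgroup that meets every coset of every subgroup of finite index. -/
def IsProdense (M : Subgroup Γ) : Prop :=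
  ∀ N : Subgroup Γ, N.FiniteIndex → ∀ g : Γ, ∃ m ∈ M, m⁻¹ * g ∈ N

end GroupLemmas

/-- An abstract multi-edge spinal group: a group generated by a rooted cyclic group `a` and a
directed elementary abelian group `b`, acting faithfully and self-similarly on the `p`-adic tree.
The element `g` translates the first level by `τ g`, and `sec g x` is its section at `x`. -/
structure SpinalGroup (p : ℕ) (V Γ : Type*) [AddCommGroup V] [Module (ZMod p) V] [Group Γ] where
  a : ZMod p → Γ
  b : V → Γ
  e : V →ₗ[ZMod p] (ZMod p → ZMod p)
  τ : Γ → ZMod p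
  sec : Γ → ZMod p → Γ
  a_add : ∀ z w, a (z + w) = a z * a w
  b_add : ∀ v w, b (v + w) = b v * b w
  e_zero : ∀ v, e v 0 = 0
  e_injective : Function.Injective e
  τ_mul : ∀ g h, τ (g * h) = τ g + τ h
  τ_a : ∀ z, τ (a z) = z
  τ_b : ∀ v, τ (b v) = 0
  sec_mul : ∀ g h x, sec (g * h) x = sec g (x + τ h) * sec h x
  sec_a : ∀ z x, sec (a z) x = 1
  sec_b_zero : ∀ v, sec (b v) 0 = b v
  sec_b : ∀ v x, x ≠ 0 → sec (b v) x = a (e v x)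
  closure_eq_top : Subgroup.closure (Set.range a ∪ Set.range b) = ⊤
  faithful : ∀ T : Set Γ, (∀ g ∈ T, τ g = 0 ∧ ∀ x, sec g x ∈ T) → ∀ g ∈ T, g = 1

/-! ### Calculus of first level sections -/

namespace SpinalGroup

variable {p : ℕ} {V Γ : Type*} [AddCommGroup V] [Module (ZMod p) V] [Group Γ]
  (D : SpinalGroup p V Γ)

theorem τ_one : D.τ 1 = 0 := by
  have := D.τ_mul 1 1
  simpa using this

theorem τ_inv (g : Γ) : D.τ g⁻¹ = -D.τ g := by
  have := D.τ_mul g⁻¹ g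
  rw [inv_mul_cancel, D.τ_one] at this
  exact eq_neg_of_add_eq_zero_left this.symm

/-- The translation part as a homomorphism. -/
def τHom : Γ →* Multiplicative (ZMod p) where
  toFun g := Multiplicative.ofAdd (D.τ g)
  map_one' := by rw [D.τ_one]; rfl
  map_mul' g h := by rw [D.τ_mul]; rfl

theorem τ_pow (g : Γ) (n : ℕ) : D.τ (g ^ n) = n * D.τ g := by
  induction n with
  | zero => simp [D.τ_one]
  | succ n ih => rw [pow_succ, D.τ_mul, ih]; push_cast; ring

theorem τ_commutator (g h : Γ) : D.τ ⁅g, h⁆ = 0 := by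
  rw [commutatorElement_def, D.τ_mul, D.τ_mul, D.τ_mul, D.τ_inv, D.τ_inv]; ring

theorem sec_one (x : ZMod p) : D.sec 1 x = 1 := by
  have := D.sec_mul 1 1 x
  rw [D.τ_one, mul_one, add_zero] at this
  exact left_eq_mul.1 this

theorem sec_inv (g : Γ) (x : ZMod p) : D.sec g⁻¹ (x + D.τ g) = (D.sec g x)⁻¹ := by
  have := D.sec_mul g⁻¹ g x
  rw [inv_mul_cancel, D.sec_one] at this
  exact eq_inv_of_mul_eq_one_left this.symm

theorem a_zero : D.a 0 = 1 := by
  have := D.a_add 0 0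
  rw [add_zero] at this
  exact left_eq_mul.1 this

theorem b_zero : D.b 0 = 1 := by
  have := D.b_add 0 0
  rw [add_zero] at this
  exact left_eq_mul.1 this

theorem a_neg (z : ZMod p) : D.a (-z) = (D.a z)⁻¹ := by
  apply eq_inv_of_mul_eq_one_left
  rw [← D.a_add, neg_add_cancel, D.a_zero]

theorem b_neg (v : V) : D.b (-v) = (D.b v)⁻¹ := by
  apply eq_inv_of_mul_eq_one_left
  rw [← D.b_add, neg_add_cancel, D.b_zero]

theorem a_nsmul (n : ℕ) (z : ZMod p) : D.a (n • z) = D.a z ^ n := by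
  induction n with
  | zero => simp [D.a_zero]
  | succ n ih => rw [succ_nsmul, D.a_add, ih, pow_succ]

theorem b_nsmul (n : ℕ) (v : V) : D.b (n • v) = D.b v ^ n := by
  induction n with
  | zero => simp [D.b_zero]
  | succ n ih => rw [succ_nsmul, D.b_add, ih, pow_succ]

theorem a_commute (z w : ZMod p) : Commute (D.a z) (D.a w) := by
  rw [Commute, SemiconjBy, ← D.a_add, ← D.a_add, add_comm]

theorem b_commute (v w : V) : Commute (D.b v) (D.b w) := by
  rw [Commute, SemiconjBy, ← D.b_add, ← D.b_add, add_comm]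

theorem eq_one_of_sec_eq_one {g : Γ} (h0 : D.τ g = 0) (h : ∀ x, D.sec g x = 1) : g = 1 := by
  refine D.faithful {g, 1} ?_ g (by simp)
  rintro k (rfl | rfl)
  · exact ⟨h0, fun x => by simp [h x]⟩
  · exact ⟨D.τ_one, fun x => by simp [D.sec_one]⟩

/-- The stabilizer of the first level. -/
def stab : Subgroup Γ := D.τHom.ker

theorem mem_stab {g : Γ} : g ∈ D.stab ↔ D.τ g = 0 := Iff.rfl

instance : D.stab.Normal := by unfold stab; infer_instance

theorem finiteIndex_stab [NeZero p] : D.stab.FiniteIndex := by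
  unfold stab; infer_instance

/-- The section at a letter, as a homomorphism on the stabilizer of the first level. -/
def secHom (x : ZMod p) : D.stab →* Γ where
  toFun g := D.sec g x
  map_one' := D.sec_one x
  map_mul' g h := by
    have : D.τ (h : Γ) = 0 := h.2
    rw [Subgroup.coe_mul, D.sec_mul, this, add_zero]

theorem sec_conj_a (s : Γ) (k y : ZMod p) :
    D.sec (D.a k * s * D.a (-k)) y = D.sec s (y - k) := by
  rw [D.sec_mul, D.sec_mul, D.sec_a, D.sec_a, D.τ_a, one_mul, mul_one, sub_eq_add_neg]

theorem τ_conj (g s : Γ) : D.τ (g * s * g⁻¹) = D.τ s := by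
  rw [D.τ_mul, D.τ_mul, D.τ_inv]; ring

theorem sec_conj (g s : Γ) (hs : D.τ s = 0) (x : ZMod p) :
    D.sec (g * s * g⁻¹) (x + D.τ g) = D.sec g x * D.sec s x * (D.sec g x)⁻¹ := by
  rw [D.sec_mul, D.sec_mul, D.sec_inv, D.τ_inv, add_neg_cancel_right, hs, add_zero]

theorem sec_conj_of_mem_stab (g s : Γ) (hg : D.τ g = 0) (hs : D.τ s = 0) (x : ZMod p) :
    D.sec (g * s * g⁻¹) x = D.sec g x * D.sec s x * (D.sec g x)⁻¹ := by
  simpa [hg] using D.sec_conj g s hs x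

theorem sec_mul_of_mem_stab (g h : Γ) (hh : D.τ h = 0) (x : ZMod p) :
    D.sec (g * h) x = D.sec g x * D.sec h x := by
  rw [D.sec_mul, hh, add_zero]

theorem sec_inv_of_mem_stab (g : Γ) (hg : D.τ g = 0) (x : ZMod p) :
    D.sec g⁻¹ x = (D.sec g x)⁻¹ := by
  simpa [hg] using D.sec_inv g x

theorem sec_pow_of_mem_stab (g : Γ) (hg : D.τ g = 0) (x : ZMod p) (n : ℕ) :
    D.sec (g ^ n) x = D.sec g x ^ n := by
  induction n with
  | zero => simp [D.sec_one]
  | succ n ih => rw [pow_succ, D.sec_mul_of_mem_stab _ _ hg, ih, pow_succ]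

theorem sec_commutator (g h : Γ) (hg : D.τ g = 0) (hh : D.τ h = 0) (x : ZMod p) :
    D.sec ⁅g, h⁆ x = ⁅D.sec g x, D.sec h x⁆ := by
  have hg' : D.τ g⁻¹ = 0 := by rw [D.τ_inv, hg, neg_zero]
  have hh' : D.τ h⁻¹ = 0 := by rw [D.τ_inv, hh, neg_zero]
  rw [commutatorElement_def, D.sec_mul_of_mem_stab _ _ hh', D.sec_mul_of_mem_stab _ _ hg',
    D.sec_mul_of_mem_stab _ _ hh, D.sec_inv_of_mem_stab _ hg, D.sec_inv_of_mem_stab _ hh,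
    commutatorElement_def]

theorem fg (D : SpinalGroup p V Γ) [Finite V] [NeZero p] : Group.FG Γ := by
  rw [Group.fg_iff]
  exact ⟨_, D.closure_eq_top, (Set.finite_range _).union (Set.finite_range _)⟩

/-! ### Exponent vectors in the torsion case, and self-replication -/

section Prime

variable [hp : Fact p.Prime]

theorem exists_e_ne_zero {v : V} (hv : v ≠ 0) : ∃ y, D.e v y ≠ 0 := by
  by_contra! h
  exact hv (D.e_injective (by rw [map_zero]; exact funext h))

/-- The orbit of `0` runs through `s, 2s, …`. The first step contributes `b v`; each later one
contributes a rooted factor, since `n < p` keeps the orbit from returning to `0`. -/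
theorem sec_pow_a_mul_b (v : V) {s : ZMod p} (hs : s ≠ 0) (n : ℕ) (hn : n < p) :
    D.sec ((D.a s * D.b v) ^ (n + 1)) 0
      = D.a (∑ i ∈ Finset.range n, D.e v ((i + 1 : ℕ) * s)) * D.b v := by
  induction n with
  | zero => simp [D.sec_mul, D.sec_a, D.sec_b_zero, D.a_zero]
  | succ n ih =>
    have hne : ((n + 1 : ℕ) : ZMod p) * s ≠ 0 := by
      refine mul_ne_zero ?_ hs
      rw [Ne, ZMod.natCast_eq_zero_iff]
      exact fun h => absurd (Nat.le_of_dvd n.succ_pos h) (by omega)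
    have hτ : D.τ (D.a s * D.b v) = s := by rw [D.τ_mul, D.τ_a, D.τ_b, add_zero]
    rw [pow_succ' _ (n + 1), D.sec_mul, ih (by omega), D.τ_pow, hτ, zero_add, D.sec_mul,
      D.sec_a, one_mul, D.sec_b _ _ hne, Finset.sum_range_succ, ← mul_assoc, ← D.a_add, add_comm]

theorem sum_range_mul {A : Type*} [AddCommMonoid A] (f : ZMod p → A) {s : ZMod p} (hs : s ≠ 0)
    (x : ZMod p) : ∑ i ∈ Finset.range p, f (x + (i : ℕ) * s) = ∑ y, f y := by
  refine Finset.sum_bij (fun i _ => x + (i : ZMod p) * s) (fun _ _ => Finset.mem_univ _) ?_ ?_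
    (fun _ _ => rfl)
  · intro i hi j hj hij
    have h1 : (i : ZMod p) = j := mul_right_cancel₀ hs (add_left_cancel hij)
    rw [ZMod.natCast_eq_natCast_iff', Nat.mod_eq_of_lt (Finset.mem_range.1 hi),
      Nat.mod_eq_of_lt (Finset.mem_range.1 hj)] at h1
    exact h1
  · intro y _
    refine ⟨((y - x) / s).val, Finset.mem_range.2 (ZMod.val_lt _), ?_⟩
    rw [ZMod.natCast_zmod_val, div_mul_cancel₀ _ hs, add_sub_cancel]

/-- If the sum `σ` were nonzero, `g = a σ * b v` would move the first level while `g ^ p` has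
section `g` at `0`. Then `p` divides the order of `g`, and the quotient by `p` already annihilates
`g`, which is absurd. -/
theorem sum_e_eq_zero (ht : IsMulTorsion Γ) (v : V) : ∑ x, D.e v x = 0 := by
  by_contra hσ
  set σ := ∑ x, D.e v x with hσ'
  set g := D.a σ * D.b v with hg
  have hτ : D.τ g = σ := by rw [hg, D.τ_mul, D.τ_a, D.τ_b, add_zero]
  have hsec : D.sec (g ^ p) 0 = g := by
    have h1 := D.sec_pow_a_mul_b v hσ (p - 1) (Nat.sub_lt hp.out.pos one_pos)
    rw [Nat.sub_add_cancel hp.out.one_le] at h1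
    rw [hg, h1]
    congr 2
    have h2 := sum_range_mul (D.e v) hσ 0
    have h3 : Finset.range p = Finset.range (p - 1 + 1) := by
      rw [Nat.sub_add_cancel hp.out.one_le]
    rw [h3, Finset.sum_range_succ'] at h2
    simpa [D.e_zero] using h2
  have hn := (ht g).orderOf_pos
  have hdvd : p ∣ orderOf g := by
    have : D.τ (g ^ orderOf g) = 0 := by rw [pow_orderOf_eq_one, D.τ_one]
    rw [D.τ_pow, hτ] at this
    exact (ZMod.natCast_eq_zero_iff _ _).1 ((mul_eq_zero.1 this).resolve_right hσ)
  obtain ⟨m, hm⟩ := hdvd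
  have h3 : g ^ m = 1 := by
    have h4 : D.τ (g ^ p) = 0 := by rw [D.τ_pow, CharP.cast_eq_zero, zero_mul]
    have h5 := D.sec_pow_of_mem_stab _ h4 0 m
    rw [hsec, ← pow_mul, ← hm, pow_orderOf_eq_one, D.sec_one] at h5
    exact h5.symm
  have h7 : 0 < m := Nat.pos_of_ne_zero fun h => by rw [h, mul_zero] at hm; omega
  have h6 := Nat.le_of_dvd h7 (orderOf_dvd_of_pow_eq_one h3)
  have := hp.out.two_le
  nlinarith

theorem exists_e_ne_zero_of_ne (ht : IsMulTorsion Γ) {v : V} (hv : v ≠ 0) (x : ZMod p) :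
    ∃ y, y ≠ x ∧ D.e v y ≠ 0 := by
  by_contra! h
  have h1 := D.sum_e_eq_zero ht v
  rw [Finset.sum_eq_single x (fun y _ hy => h y hy) (by simp)] at h1
  obtain ⟨y, hy⟩ := D.exists_e_ne_zero hv
  by_cases hyx : y = x
  · exact hy (hyx ▸ h1)
  · exact hy (h y hyx)

theorem ne_zero_of_e_ne_zero {v : V} {y : ZMod p} (h : D.e v y ≠ 0) : y ≠ 0 := by
  rintro rfl
  exact h (D.e_zero v)

theorem exists_e_eq {v : V} {y : ZMod p} (h : D.e v y ≠ 0) (z : ZMod p) : ∃ u, D.e u y = z :=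
  ⟨(z / D.e v y) • v, by
    rw [map_smul, Pi.smul_apply, smul_eq_mul, div_mul_cancel₀ _ h]⟩

/-- Conjugating directed elements by rooted ones moves any of their coordinates to `x`, so every
generator occurs as a section there. -/
theorem exists_sec_eq [Nontrivial V] (x : ZMod p) (g : Γ) : ∃ s, D.τ s = 0 ∧ D.sec s x = g := by
  suffices h : (D.secHom x).range = ⊤ by
    obtain ⟨s, hs⟩ := (h ▸ Subgroup.mem_top g : g ∈ (D.secHom x).range)
    exact ⟨s, s.2, hs⟩
  rw [eq_top_iff, ← D.closure_eq_top, Subgroup.closure_le]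
  obtain ⟨v, hv⟩ := exists_ne (0 : V)
  obtain ⟨y, hy⟩ := D.exists_e_ne_zero hv
  rintro _ (⟨z, rfl⟩ | ⟨w, rfl⟩)
  · obtain ⟨u, hu⟩ := D.exists_e_eq hy z
    refine ⟨⟨D.a (x - y) * D.b u * D.a (-(x - y)), ?_⟩, ?_⟩
    · rw [D.a_neg, D.mem_stab, D.τ_conj, D.τ_b]
    · change D.sec _ x = _
      rw [D.sec_conj_a, sub_sub_cancel, D.sec_b _ _ (D.ne_zero_of_e_ne_zero hy), hu]
  · refine ⟨⟨D.a x * D.b w * D.a (-x), ?_⟩, ?_⟩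
    · rw [D.a_neg, D.mem_stab, D.τ_conj, D.τ_b]
    · change D.sec _ x = _
      rw [D.sec_conj_a, sub_self, D.sec_b_zero]

end Prime

end SpinalGroup

/-! ### Prescribed sections, rigid stabilizers and level stabilizers -/

namespace SpinalGroup

variable {p : ℕ} {V Γ : Type*} [AddCommGroup V] [Module (ZMod p) V] [Group Γ]
  (D : SpinalGroup p V Γ)

/-- The elements of the first level stabilizer with sections in prescribed subgroups. -/
def withSections (H : ZMod p → Subgroup Γ) : Subgroup Γ :=
  (⨅ x, (H x).comap (D.secHom x)).map D.stab.subtype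

theorem mem_withSections {H : ZMod p → Subgroup Γ} {g : Γ} :
    g ∈ D.withSections H ↔ D.τ g = 0 ∧ ∀ x, D.sec g x ∈ H x := by
  constructor
  · rintro ⟨s, hs, rfl⟩
    exact ⟨s.2, fun x => Subgroup.mem_iInf.1 hs x⟩
  · rintro ⟨h0, h⟩
    exact ⟨⟨g, h0⟩, Subgroup.mem_iInf.2 h, rfl⟩

theorem finiteIndex_withSections [NeZero p] {H : ZMod p → Subgroup Γ}
    (h : ∀ x, (H x).FiniteIndex) : (D.withSections H).FiniteIndex := by
  have h1 : (⨅ x, (H x).comap (D.secHom x)).FiniteIndex :=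
    Subgroup.finiteIndex_iInf fun x => ⟨by
      have := h x
      rw [Subgroup.index_comap]
      exact ((H x).instFiniteIndex_subgroupOf (D.secHom x).range).index_ne_zero⟩
  refine ⟨?_⟩
  rw [withSections, Subgroup.index_map_subtype]
  exact mul_ne_zero h1.index_ne_zero D.finiteIndex_stab.index_ne_zero

/-- The sections at `x` of those elements of the first level stabilizer of `H` whose sections at
the letters in `A` are trivial. -/
def lift (H : Subgroup Γ) (x : ZMod p) (A : Finset (ZMod p)) : Subgroup Γ where
  carrier := {g | ∃ s ∈ H, D.τ s = 0 ∧ D.sec s x = g ∧ ∀ l ∈ A, D.sec s l = 1}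
  mul_mem' := by
    rintro _ _ ⟨s, hs, hs0, rfl, hsA⟩ ⟨t, ht, ht0, rfl, htA⟩
    refine ⟨s * t, mul_mem hs ht, by rw [D.τ_mul, hs0, ht0, add_zero],
      D.sec_mul_of_mem_stab _ _ ht0 x, fun l hl => ?_⟩
    rw [D.sec_mul_of_mem_stab _ _ ht0, hsA l hl, htA l hl, one_mul]
  one_mem' := ⟨1, one_mem _, D.τ_one, D.sec_one x, fun l _ => D.sec_one l⟩
  inv_mem' := by
    rintro _ ⟨s, hs, hs0, rfl, hsA⟩
    refine ⟨s⁻¹, inv_mem hs, by rw [D.τ_inv, hs0, neg_zero], D.sec_inv_of_mem_stab _ hs0 x,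
      fun l hl => ?_⟩
    rw [D.sec_inv_of_mem_stab _ hs0, hsA l hl, inv_one]

theorem mem_lift {H : Subgroup Γ} {x : ZMod p} {A : Finset (ZMod p)} {g : Γ} :
    g ∈ D.lift H x A ↔ ∃ s ∈ H, D.τ s = 0 ∧ D.sec s x = g ∧ ∀ l ∈ A, D.sec s l = 1 := Iff.rfl

theorem commutator_lift_le (H K : Subgroup Γ) (x : ZMod p) (A B : Finset (ZMod p)) :
    ⁅D.lift H x A, D.lift K x B⁆ ≤ D.lift ⁅H, K⁆ x (A ∪ B) := by
  rw [Subgroup.commutator_le]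
  rintro _ ⟨s, hs, hs0, rfl, hsA⟩ _ ⟨t, ht, ht0, rfl, htB⟩
  refine ⟨⁅s, t⁆, Subgroup.commutator_mem_commutator hs ht, D.τ_commutator _ _,
    D.sec_commutator _ _ hs0 ht0 x, fun l hl => ?_⟩
  rw [D.sec_commutator _ _ hs0 ht0]
  rcases Finset.mem_union.1 hl with h | h
  · rw [hsA l h, commutatorElement_one_left]
  · rw [htB l h, commutatorElement_one_right]

theorem lift_mono {H K : Subgroup Γ} (h : H ≤ K) (x : ZMod p) {A B : Finset (ZMod p)}
    (hBA : B ⊆ A) : D.lift H x A ≤ D.lift K x B := by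
  rintro _ ⟨s, hs, hs0, rfl, hsA⟩
  exact ⟨s, h hs, hs0, rfl, fun l hl => hsA l (hBA hl)⟩

theorem lift_normal {H : Subgroup Γ} {x : ZMod p} (A : Finset (ZMod p))
    (h : ∀ g, ∃ s, D.τ s = 0 ∧ D.sec s x = g ∧ ∀ d ∈ H, s * d * s⁻¹ ∈ H) :
    (D.lift H x A).Normal := by
  refine ⟨?_⟩
  rintro _ ⟨s, hs, hs0, rfl, hsA⟩ g
  obtain ⟨t, ht0, rfl, ht⟩ := h g
  refine ⟨t * s * t⁻¹, ht s hs, by rw [D.τ_conj, hs0], D.sec_conj_of_mem_stab _ _ ht0 hs0 x,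
    fun l hl => ?_⟩
  rw [D.sec_conj_of_mem_stab _ _ ht0 hs0, hsA l hl, mul_one, mul_inv_cancel]

/-- A subgroup is contained in `H` if it consists of elements with sections in the rigid
stabilizers of `H` on the first level. -/
theorem withSections_lift_le [NeZero p] (H : Subgroup Γ) :
    D.withSections (fun x => D.lift H x (Finset.univ.erase x)) ≤ H := by
  suffices h : ∀ (A : Finset (ZMod p)) (s : Γ), D.τ s = 0 →
      (∀ x, D.sec s x ∈ D.lift H x (Finset.univ.erase x)) → (∀ x ∉ A, D.sec s x = 1) → s ∈ H by
    intro s hs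
    rw [D.mem_withSections] at hs
    exact h Finset.univ s hs.1 hs.2 fun x hx => absurd (Finset.mem_univ x) hx
  -- The letters are cleared one at a time: dividing by an element of `H` supported at `y` alone
  -- removes the section at `y` and changes no other.
  intro A
  induction A using Finset.induction_on with
  | empty =>
    intro s hs0 _ hs
    rw [D.eq_one_of_sec_eq_one hs0 fun x => hs x (Finset.notMem_empty x)]
    exact one_mem H
  | insert y A hy ih =>
    intro s hs0 hs hsA
    obtain ⟨m, hm, hm0, hmy, hml⟩ := hs y
    have hm0' : D.τ m⁻¹ = 0 := by rw [D.τ_inv, hm0, neg_zero]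
    have hsec : ∀ x, D.sec (m⁻¹ * s) x = (D.sec m x)⁻¹ * D.sec s x := fun x => by
      rw [D.sec_mul_of_mem_stab _ _ hs0, D.sec_inv_of_mem_stab _ hm0]
    have h1 : ∀ x, x ≠ y → D.sec (m⁻¹ * s) x = D.sec s x := fun x hx => by
      rw [hsec, hml x (by simpa using hx), inv_one, one_mul]
    have h2 : D.sec (m⁻¹ * s) y = 1 := by rw [hsec, hmy, inv_mul_cancel]
    have : m⁻¹ * s ∈ H := by
      refine ih _ (by rw [D.τ_mul, hm0', hs0, add_zero]) (fun x => ?_) fun x hx => ?_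
      · by_cases hxy : x = y
        · rw [hxy, h2]; exact one_mem _
        · rw [h1 x hxy]; exact hs x
      · by_cases hxy : x = y
        · rw [hxy, h2]
        · rw [h1 x hxy]
          exact hsA x (by simp [hxy, hx])
    simpa using mul_mem hm this

theorem finiteIndex_of_finiteIndex_lift [NeZero p] {H : Subgroup Γ}
    (h : ∀ x, (D.lift H x (Finset.univ.erase x)).FiniteIndex) : H.FiniteIndex :=
  have := D.finiteIndex_withSections h
  Subgroup.finiteIndex_of_le (D.withSections_lift_le H)

/-- The pointwise stabilizer of a level of the tree. -/
def levelStab : ℕ → Subgroup Γ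
  | 0 => ⊤
  | n + 1 => D.withSections fun _ => levelStab n

theorem mem_levelStab_succ {n : ℕ} {g : Γ} :
    g ∈ D.levelStab (n + 1) ↔ D.τ g = 0 ∧ ∀ x, D.sec g x ∈ D.levelStab n :=
  D.mem_withSections

theorem finiteIndex_levelStab [NeZero p] (n : ℕ) : (D.levelStab n).FiniteIndex := by
  induction n with
  | zero => unfold levelStab; infer_instance
  | succ n ih => exact D.finiteIndex_withSections fun _ => ih

theorem eq_one_of_mem_levelStab {g : Γ} (h : ∀ n, g ∈ D.levelStab n) : g = 1 := by
  refine D.faithful {g | ∀ n, g ∈ D.levelStab n} ?_ g h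
  intro k hk
  exact ⟨(D.mem_levelStab_succ.1 (hk 1)).1, fun x n => (D.mem_levelStab_succ.1 (hk (n + 1))).2 x⟩

/-! ### The `p`-group property, branching, and normal subgroups -/

section Prime

variable [hp : Fact p.Prime]

theorem exists_pow_mem_levelStab (n : ℕ) (g : Γ) : ∃ k, g ^ p ^ k ∈ D.levelStab n := by
  induction n generalizing g with
  | zero => exact ⟨0, Subgroup.mem_top _⟩
  | succ n ih =>
    have h0 : D.τ (g ^ p) = 0 := by rw [D.τ_pow, CharP.cast_eq_zero, zero_mul]
    choose k hk using fun x => ih (D.sec (g ^ p) x)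
    refine ⟨1 + ∑ x, k x, D.mem_levelStab_succ.2 ⟨?_, fun x => ?_⟩⟩
    · rw [pow_add, pow_one, pow_mul, D.τ_pow, h0, mul_zero]
    · rw [pow_add, pow_one, pow_mul, D.sec_pow_of_mem_stab _ h0]
      obtain ⟨d, hd⟩ := Nat.exists_eq_add_of_le (Finset.single_le_sum (f := k)
        (fun i _ => Nat.zero_le (k i)) (Finset.mem_univ x))
      rw [hd, pow_add, pow_mul]
      exact pow_mem (hk x) _

/-- The part of `g` of order prime to `p` is a power of each of its own `p`-power powers. Some such
power lies in any given level stabilizer, and these intersect trivially. -/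
theorem isPGroup (D : SpinalGroup p V Γ) (ht : IsMulTorsion Γ) : IsPGroup p Γ := by
  intro g
  obtain ⟨k, m, hm, hkm⟩ := Nat.exists_eq_pow_mul_and_not_dvd (ht g).orderOf_pos.ne' p
    hp.out.ne_one
  refine ⟨k, D.eq_one_of_mem_levelStab fun n => ?_⟩
  obtain ⟨j, hj⟩ := D.exists_pow_mem_levelStab n (g ^ p ^ k)
  have hord : orderOf (g ^ p ^ k) ∣ m := by
    apply orderOf_dvd_of_pow_eq_one
    rw [← pow_mul, ← hkm, pow_orderOf_eq_one]
  have hcop : (p ^ j).Coprime (orderOf (g ^ p ^ k)) :=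
    Nat.Coprime.coprime_dvd_right hord
      (Nat.Coprime.pow_left j ((Nat.Prime.coprime_iff_not_dvd hp.out).2 hm))
  obtain ⟨i, hi⟩ := exists_pow_eq_self_of_coprime hcop
  rw [← hi]
  exact pow_mem hj i

theorem lift_normal_of_normal [Nontrivial V] (H : Subgroup Γ) [hH : H.Normal] (x : ZMod p)
    (A : Finset (ZMod p)) : (D.lift H x A).Normal := by
  refine D.lift_normal A fun g => ?_
  obtain ⟨s, hs0, hs⟩ := D.exists_sec_eq x g
  exact ⟨s, hs0, hs, fun d hd => hH.conj_mem d hd s⟩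

/-- Two conjugated directed elements are chosen to have sections `b v` and `a z` at `x`, and rooted,
hence commuting, sections at `l`. The second needs a nonzero coordinate `y ≠ x - l`, which exists
because a nonzero vector has two nonzero coordinates. -/
theorem commutator_le_lift [Nontrivial V] (ht : IsMulTorsion Γ) {x l : ZMod p} (hxl : l ≠ x) :
    commutator Γ ≤ D.lift (commutator Γ) x {l} := by
  have hn := D.lift_normal_of_normal (commutator Γ) x {l}
  obtain ⟨v₀, hv₀⟩ := exists_ne (0 : V)
  obtain ⟨y, hyl, hy⟩ := D.exists_e_ne_zero_of_ne ht hv₀ (x - l)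
  have hy0 := D.ne_zero_of_e_ne_zero hy
  have key : ∀ v z, ⁅D.b v, D.a z⁆ ∈ D.lift (commutator Γ) x {l} := by
    intro v z
    obtain ⟨u, hu⟩ := D.exists_e_eq hy z
    refine ⟨⁅D.a x * D.b v * D.a (-x), D.a (x - y) * D.b u * D.a (-(x - y))⁆,
      Subgroup.commutator_mem_commutator (Subgroup.mem_top _) (Subgroup.mem_top _),
      D.τ_commutator _ _, ?_, ?_⟩
    · rw [D.sec_commutator _ _ (by rw [D.a_neg, D.τ_conj, D.τ_b])
        (by rw [D.a_neg, D.τ_conj, D.τ_b]), D.sec_conj_a, D.sec_conj_a, sub_self,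
        D.sec_b_zero, sub_sub_cancel, D.sec_b _ _ hy0, hu]
    · intro l' hl'
      obtain rfl := Finset.mem_singleton.1 hl'
      have h1 : l' - (x - y) ≠ 0 := fun h => hyl (by linear_combination h)
      rw [D.sec_commutator _ _ (by rw [D.a_neg, D.τ_conj, D.τ_b])
        (by rw [D.a_neg, D.τ_conj, D.τ_b]), D.sec_conj_a, D.sec_conj_a,
        D.sec_b _ _ (sub_ne_zero.2 hxl), D.sec_b _ _ h1, commutatorElement_eq_one_iff_commute]
      exact D.a_commute _ _
  refine commutator_le_of_closure_eq_top D.closure_eq_top _ ?_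
  rintro _ (⟨z, rfl⟩ | ⟨v, rfl⟩) _ (⟨w, rfl⟩ | ⟨u, rfl⟩)
  · rw [commutatorElement_eq_one_iff_commute.2 (D.a_commute z w)]; exact one_mem _
  · rw [← commutatorElement_inv]; exact inv_mem (key u z)
  · exact key v w
  · rw [commutatorElement_eq_one_iff_commute.2 (D.b_commute v u)]; exact one_mem _

/-- A commutator has trivial section wherever either entry does, so each derived step allows one
more letter to be cleared. -/
theorem derivedSeries_le_lift [Nontrivial V] (ht : IsMulTorsion Γ) (x : ZMod p) (j : ℕ)
    (A : Finset (ZMod p)) (hxA : x ∉ A) (hA : A.card ≤ j + 1) :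
    derivedSeries Γ (j + 1) ≤ D.lift (derivedSeries Γ (j + 1)) x A := by
  induction j generalizing A with
  | zero =>
    obtain ⟨l, hl⟩ := Finset.card_le_one_iff_subset_singleton.1 hA
    rw [zero_add, derivedSeries_one]
    by_cases hlx : l = x
    -- Here `A` is empty, and `x + 1` serves only as some letter other than `x`.
    · have : A ⊆ {x + 1} := fun i hi => by
        have := Finset.mem_singleton.1 (hl hi)
        exact absurd (hlx ▸ this ▸ hi) hxA
      exact (D.commutator_le_lift ht (by simp)).trans (D.lift_mono le_rfl x this)
    · exact (D.commutator_le_lift ht hlx).trans (D.lift_mono le_rfl x hl)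
  | succ j ih =>
    rw [derivedSeries_succ]
    obtain ⟨B, C, rfl, hB, hC⟩ : ∃ B C, A = B ∪ C ∧ B.card ≤ j + 1 ∧ C.card ≤ j + 1 := by
      rcases A.eq_empty_or_nonempty with rfl | ⟨l, hl⟩
      · exact ⟨∅, ∅, by simp⟩
      · refine ⟨A.erase l, {l}, by
          rw [Finset.union_comm]; simp [Finset.insert_erase hl], ?_, by simp⟩
        rw [Finset.card_erase_of_mem hl]; omega
    exact (Subgroup.commutator_mono (ih B (fun h => hxA (Finset.mem_union_left _ h)) hB)
      (ih C (fun h => hxA (Finset.mem_union_right _ h)) hC)).trans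
      (D.commutator_lift_le _ _ x B C)

/-- The group is weakly regular branch over this subgroup. -/
theorem derivedSeries_le_lift_erase [Nontrivial V] (ht : IsMulTorsion Γ) (x : ZMod p) :
    derivedSeries Γ (p - 1) ≤ D.lift (derivedSeries Γ (p - 1)) x (Finset.univ.erase x) := by
  have h2 := hp.out.two_le
  obtain ⟨j, hj⟩ : ∃ j, p - 1 = j + 1 := ⟨p - 2, by omega⟩
  have := D.derivedSeries_le_lift ht x j (Finset.univ.erase x) (by simp)
    (by rw [Finset.card_erase_of_mem (Finset.mem_univ x), Finset.card_univ, ZMod.card, hj])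
  rwa [← hj] at this

/-- Asking only for the double commutators, rather than `g ∈ N`, gives a hypothesis that passes to
sections. Branching lifts `k₁`, `k₂` to elements supported at one letter, so the rigid stabilizer of
`N` there satisfies the same hypothesis for the section of `g`. Once `g` moves the first level, that
rigid stabilizer contains a commutator subgroup of finite index. -/
theorem finiteIndex_of_commutator_mem [Nontrivial V] [Finite V] (ht : IsMulTorsion Γ) (n : ℕ)
    (g : Γ) (hg : g ∉ D.levelStab n) (N : Subgroup Γ) [hN : N.Normal]
    (h : ∀ k₁ ∈ derivedSeries Γ (p - 1), ∀ k₂ ∈ derivedSeries Γ (p - 1), ⁅⁅k₁, g⁆, k₂⁆ ∈ N) :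
    N.FiniteIndex := by
  have := D.fg
  induction n generalizing g N with
  | zero => exact absurd (Subgroup.mem_top g) hg
  | succ n ih =>
    suffices hx : ∃ x, (D.lift N x (Finset.univ.erase x)).FiniteIndex by
      obtain ⟨x, hx⟩ := hx
      refine D.finiteIndex_of_finiteIndex_lift fun y => ?_
      refine Subgroup.finiteIndex_of_le (H := D.lift N x (Finset.univ.erase x)) ?_
      rintro _ ⟨s, hs, hs0, rfl, hsA⟩
      refine ⟨D.a (y - x) * s * D.a (-(y - x)), ?_, ?_, ?_, ?_⟩
      · rw [D.a_neg]; exact hN.conj_mem s hs _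
      · rw [D.a_neg, D.τ_conj, hs0]
      · rw [D.sec_conj_a, sub_sub_cancel]
      · intro l hl
        rw [D.sec_conj_a]
        refine hsA _ (Finset.mem_erase.2 ⟨fun h => Finset.ne_of_mem_erase hl ?_,
          Finset.mem_univ _⟩)
        linear_combination h
    have hK := fun x => D.derivedSeries_le_lift_erase ht x
    by_cases h0 : D.τ g = 0
    · obtain ⟨x, hx⟩ : ∃ x, D.sec g x ∉ D.levelStab n := by
        by_contra! h1
        exact hg (D.mem_levelStab_succ.2 ⟨h0, h1⟩)
      have := D.lift_normal_of_normal N x (Finset.univ.erase x)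
      refine ⟨x, ih _ hx _ fun k₁ hk₁ k₂ hk₂ => ?_⟩
      obtain ⟨s, hs, hs0, rfl, hsA⟩ := hK x hk₁
      obtain ⟨t, ht, ht0, rfl, htA⟩ := hK x hk₂
      refine ⟨⁅⁅s, g⁆, t⁆, h s hs t ht, D.τ_commutator _ _, ?_, fun l hl => ?_⟩
      · rw [D.sec_commutator _ _ (D.τ_commutator _ _) ht0, D.sec_commutator _ _ hs0 h0]
      · rw [D.sec_commutator _ _ (D.τ_commutator _ _) ht0, htA l hl, commutatorElement_one_right]
    · refine ⟨0, ?_⟩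
      have hfin := finiteIndex_derivedSeries ht (p - 1)
      have hfin' := finiteIndex_commutator_self ht (derivedSeries Γ (p - 1))
      refine Subgroup.finiteIndex_of_le (Subgroup.commutator_le.2 fun k₁ hk₁ k₂ hk₂ => ?_ :
        ⁅derivedSeries Γ (p - 1), derivedSeries Γ (p - 1)⁆ ≤ _)
      obtain ⟨s, hs, hs0, rfl, hsA⟩ := hK 0 hk₁
      obtain ⟨t, ht, ht0, rfl, htA⟩ := hK 0 hk₂
      have hs0' : D.τ s⁻¹ = 0 := by rw [D.τ_inv, hs0, neg_zero]
      -- As `g` moves `0`, the conjugate of `s⁻¹` by `g` is supported away from `0`.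
      have hsec : D.sec ⁅s, g⁆ 0 = D.sec s 0 := by
        have h1 : ⁅s, g⁆ = s * (g * s⁻¹ * g⁻¹) := by rw [commutatorElement_def]; group
        have h2 := D.sec_conj g s⁻¹ hs0' (-D.τ g)
        rw [D.sec_inv_of_mem_stab _ hs0, hsA _ (by simpa using h0), inv_one, mul_one,
          mul_inv_cancel, neg_add_cancel] at h2
        rw [h1, D.sec_mul_of_mem_stab _ _ (by rw [D.τ_conj, hs0']), h2, mul_one]
      refine ⟨⁅⁅s, g⁆, t⁆, h s hs t ht, D.τ_commutator _ _, ?_, fun l hl => ?_⟩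
      · rw [D.sec_commutator _ _ (D.τ_commutator _ _) ht0, hsec]
      · rw [D.sec_commutator _ _ (D.τ_commutator _ _) ht0, htA l hl, commutatorElement_one_right]

theorem finiteIndex_of_ne_bot (D : SpinalGroup p V Γ) [Nontrivial V] [Finite V]
    (ht : IsMulTorsion Γ) (N : Subgroup Γ) [hN : N.Normal] (h : N ≠ ⊥) : N.FiniteIndex := by
  obtain ⟨g, hg, hg1⟩ := N.bot_or_exists_ne_one.resolve_left h
  obtain ⟨n, hn⟩ : ∃ n, g ∉ D.levelStab n := by
    by_contra! h1
    exact hg1 (D.eq_one_of_mem_levelStab h1)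
  refine D.finiteIndex_of_commutator_mem ht n g hn N fun k₁ _ k₂ _ => ?_
  have h1 : ⁅k₁, g⁆ ∈ N := by
    rw [commutatorElement_def]
    exact mul_mem (hN.conj_mem g hg k₁) (inv_mem hg)
  have h2 : ⁅⁅k₁, g⁆, k₂⁆ = ⁅k₁, g⁆ * (k₂ * ⁅k₁, g⁆⁻¹ * k₂⁻¹) := by
    rw [commutatorElement_def ⁅k₁, g⁆]; group
  rw [h2]
  exact mul_mem h1 (hN.conj_mem _ (inv_mem h1) k₂)

end Prime

end SpinalGroup

/-! ### Prodense subgroups and conjugation -/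

section GroupLemmas

variable {Γ : Type*} [Group Γ]

theorem IsProdense.map_conj {M : Subgroup Γ} (hM : IsProdense M) (g : Γ) :
    IsProdense (M.map (MulAut.conj g).toMonoidHom) := by
  intro N hN h
  have hcore := N.finiteIndex_normalCore
  obtain ⟨m, hm, hmN⟩ := hM N.normalCore hcore (g⁻¹ * h * g)
  refine ⟨g * m * g⁻¹, ⟨m, hm, rfl⟩, N.normalCore_le ?_⟩
  have h1 := (inferInstance : N.normalCore.Normal).conj_mem _ hmN g
  have h2 : (g * m * g⁻¹)⁻¹ * h = g * (m⁻¹ * (g⁻¹ * h * g)) * g⁻¹ := by group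
  rwa [h2]

theorem map_conj_ne_top {M : Subgroup Γ} (hM : M ≠ ⊤) (g : Γ) :
    M.map (MulAut.conj g).toMonoidHom ≠ ⊤ := by
  intro h
  refine hM (Subgroup.map_injective
    (f := (MulAut.conj g).toMonoidHom) (MulAut.conj g).injective ?_)
  exact h.trans (Subgroup.map_top_of_surjective _ (MulAut.conj g).surjective).symm

theorem mem_map_conj {M : Subgroup Γ} {g x : Γ} (h : g⁻¹ * x * g ∈ M) :
    x ∈ M.map (MulAut.conj g).toMonoidHom :=
  ⟨_, h, by simp [mul_assoc]⟩

/-- A proper subgroup that is dense in the profinite topology. -/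
structure IsProperProdense (M : Subgroup Γ) : Prop where
  prodense : IsProdense M
  ne_top : M ≠ ⊤

theorem IsProperProdense.map_conj {M : Subgroup Γ} (hM : IsProperProdense M) (g : Γ) :
    IsProperProdense (M.map (MulAut.conj g).toMonoidHom) :=
  ⟨hM.prodense.map_conj g, map_conj_ne_top hM.ne_top g⟩

end GroupLemmas

/-! ### Sections of proper prodense subgroups -/

namespace SpinalGroup

variable {p : ℕ} {V Γ : Type*} [AddCommGroup V] [Module (ZMod p) V] [Group Γ]
  (D : SpinalGroup p V Γ)

/-- The group of sections at `x` of the first level stabilizer of `M`. -/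
def secSubgroup (M : Subgroup Γ) (x : ZMod p) : Subgroup Γ := D.lift M x ∅

theorem mem_secSubgroup {M : Subgroup Γ} {x : ZMod p} {g : Γ} :
    g ∈ D.secSubgroup M x ↔ ∃ m ∈ M, D.τ m = 0 ∧ D.sec m x = g := by
  simp [secSubgroup, mem_lift]

theorem sec_mem_secSubgroup {M : Subgroup Γ} {m : Γ} (hm : m ∈ M) (h0 : D.τ m = 0) (x : ZMod p) :
    D.sec m x ∈ D.secSubgroup M x :=
  D.mem_secSubgroup.2 ⟨m, hm, h0, rfl⟩

section Prime

variable [hp : Fact p.Prime]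

theorem exists_mem_τ_eq (D : SpinalGroup p V Γ) {M : Subgroup Γ} (hM : IsProdense M) (t : ZMod p) :
    ∃ m ∈ M, D.τ m = t := by
  obtain ⟨m, hm, h⟩ := hM _ D.finiteIndex_stab (D.a t)
  refine ⟨m, hm, ?_⟩
  rw [D.mem_stab, D.τ_mul, D.τ_inv, D.τ_a] at h
  linear_combination -h

/-- A prodense subgroup is transitive on the first level, so its section groups at different letters
are conjugate in `Γ`. -/
theorem secSubgroup_eq_top_of_eq_top {M : Subgroup Γ} (hM : IsProdense M) {x : ZMod p}
    (hx : D.secSubgroup M x = ⊤) (y : ZMod p) : D.secSubgroup M y = ⊤ := by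
  obtain ⟨m, hm, ht⟩ := D.exists_mem_τ_eq hM (y - x)
  rw [eq_top_iff]
  intro g _
  obtain ⟨s, hs, hs0, hsx⟩ := D.mem_secSubgroup.1
    (hx ▸ Subgroup.mem_top ((D.sec m x)⁻¹ * g * D.sec m x))
  refine D.mem_secSubgroup.2 ⟨m * s * m⁻¹, mul_mem (mul_mem hm hs) (inv_mem hm),
    by rw [D.τ_conj, hs0], ?_⟩
  have h := D.sec_conj m s hs0 x
  rw [ht, add_sub_cancel, hsx] at h
  rw [h]; group

variable [Nontrivial V]

theorem isProdense_secSubgroup {M : Subgroup Γ} (hM : IsProdense M) (x : ZMod p) :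
    IsProdense (D.secSubgroup M x) := by
  intro N hN g
  obtain ⟨s, hs0, rfl⟩ := D.exists_sec_eq x g
  obtain ⟨m, hm, hmN⟩ := hM _ (D.finiteIndex_withSections fun _ => hN) s
  obtain ⟨h1, h2⟩ := D.mem_withSections.1 hmN
  have hm0 : D.τ m = 0 := by simpa [D.τ_mul, D.τ_inv, hs0] using h1
  refine ⟨_, D.sec_mem_secSubgroup hm hm0 x, ?_⟩
  have h3 := h2 x
  rwa [D.sec_mul_of_mem_stab _ _ hs0, D.sec_inv_of_mem_stab _ hm0] at h3

variable [Finite V]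

/-- This subgroup is normal because the sections of `M` fill `Γ`. Were it trivial, the section at
`y` would determine the section at `x` on the first level stabilizer of `M`. Approximating by `M` a
branch element with trivial section at `y` and section `k` at `x` then forces `k` into every level
stabilizer, so the branching subgroup is trivial and `Γ` is finite. -/
theorem finiteIndex_lift_singleton (ht : IsMulTorsion Γ) {M : Subgroup Γ} (hM : IsProdense M)
    (hsec : ∀ x, D.secSubgroup M x = ⊤) {x y : ZMod p} (hxy : y ≠ x) :
    (D.lift M x {y}).FiniteIndex := by
  have := D.fg
  have hn : (D.lift M x {y}).Normal := by
    refine D.lift_normal _ fun g => ?_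
    obtain ⟨s, hs, hs0, hsx⟩ := D.mem_secSubgroup.1 (hsec x ▸ Subgroup.mem_top g)
    exact ⟨s, hs0, hsx, fun d hd => mul_mem (mul_mem hs hd) (inv_mem hs)⟩
  by_cases hbot : D.lift M x {y} = ⊥
  swap
  · exact D.finiteIndex_of_ne_bot ht _ hbot
  suffices hK : derivedSeries Γ (p - 1) = ⊥ by
    rw [hbot, ← hK]
    exact finiteIndex_derivedSeries ht _
  rw [eq_bot_iff]
  intro k hk
  refine Subgroup.mem_bot.2 (D.eq_one_of_mem_levelStab fun n => ?_)
  have hinj : ∀ m ∈ M, ∀ m' ∈ M, D.τ m = 0 → D.τ m' = 0 → D.sec m y = D.sec m' y →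
      D.sec m x = D.sec m' x := by
    intro m hm m' hm' h0 h0' h
    have h0i : D.τ m⁻¹ = 0 := by rw [D.τ_inv, h0, neg_zero]
    have : D.sec (m⁻¹ * m') x ∈ D.lift M x {y} := by
      refine ⟨_, mul_mem (inv_mem hm) hm', by rw [D.τ_mul, h0i, h0', add_zero], rfl, ?_⟩
      simp [D.sec_mul_of_mem_stab _ _ h0', D.sec_inv_of_mem_stab _ h0, h]
    rw [hbot, Subgroup.mem_bot, D.sec_mul_of_mem_stab _ _ h0', D.sec_inv_of_mem_stab _ h0] at this
    exact inv_mul_eq_one.1 this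
  set L := D.levelStab n
  have hL : L.FiniteIndex := D.finiteIndex_levelStab n
  set f : (M ⊓ D.stab : Subgroup Γ) →* Γ := (D.secHom x).comp (Subgroup.inclusion inf_le_right)
  set f' : (M ⊓ D.stab : Subgroup Γ) →* Γ := (D.secHom y).comp (Subgroup.inclusion inf_le_right)
  have hf' : Function.Surjective f' := by
    intro g
    obtain ⟨s, hs, hs0, hsx⟩ := D.mem_secSubgroup.1 (hsec y ▸ Subgroup.mem_top g)
    exact ⟨⟨s, hs, hs0⟩, hsx⟩
  have hL' : ((L.comap f).map f').FiniteIndex := by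
    refine ⟨fun h0 => ?_⟩
    have h1 := Subgroup.index_map_dvd (L.comap f) hf'
    rw [h0, zero_dvd_iff, Subgroup.index_comap] at h1
    exact (L.instFiniteIndex_subgroupOf f.range).index_ne_zero h1
  -- The second factor is chosen so that a section at `y` inside it guarantees a section at `x` in
  -- `L`.
  have hN : ∀ _ : ZMod p, (L ⊓ (L.comap f).map f').FiniteIndex := fun _ => inferInstance
  obtain ⟨s, -, hs0, hsx, hsl⟩ := D.derivedSeries_le_lift_erase ht x hk
  obtain ⟨m, hm, hmN⟩ := hM _ (D.finiteIndex_withSections hN) s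
  obtain ⟨h1, h2⟩ := D.mem_withSections.1 hmN
  have hm0 : D.τ m = 0 := by simpa [D.τ_mul, D.τ_inv, hs0] using h1
  have hx := (Subgroup.mem_inf.1 (h2 x)).1
  have hy := (Subgroup.mem_inf.1 (h2 y)).2
  rw [D.sec_mul_of_mem_stab _ _ hs0, D.sec_inv_of_mem_stab _ hm0] at hx hy
  rw [hsl y (by simpa using hxy), mul_one] at hy
  obtain ⟨m', hm', hm'y⟩ := inv_mem hy
  have h3 := hinj m hm m' m'.2.1 hm0 m'.2.2 (by rw [inv_inv] at hm'y; exact hm'y.symm)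
  have h4 : D.sec m x ∈ L := by rw [h3]; exact hm'
  have h5 := mul_mem h4 hx
  rwa [mul_inv_cancel_left, hsx] at h5

/-- Commutators of the finite index subgroups for single letters show that the rigid stabilizers of
`M` have finite index. Hence `M` has finite index, and being prodense it is everything. -/
theorem eq_top_of_secSubgroup_eq_top (ht : IsMulTorsion Γ) {M : Subgroup Γ} (hM : IsProdense M)
    {x : ZMod p} (hx : D.secSubgroup M x = ⊤) : M = ⊤ := by
  have := D.fg
  have hsec := D.secSubgroup_eq_top_of_eq_top hM hx
  have hlift : ∀ y (A : Finset (ZMod p)), y ∉ A → (D.lift M y A).FiniteIndex := by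
    intro y A
    induction A using Finset.induction_on with
    | empty => intro _; change (D.secSubgroup M y).FiniteIndex; rw [hsec]; infer_instance
    | insert z A hz ih =>
      intro hy
      have h1 := ih fun h => hy (Finset.mem_insert_of_mem h)
      have h2 := D.finiteIndex_lift_singleton ht hM hsec (x := y) (y := z)
        fun h => hy (h ▸ Finset.mem_insert_self _ _)
      have := finiteIndex_commutator ht (D.lift M y {z}) (D.lift M y A)
      exact Subgroup.finiteIndex_of_le ((D.commutator_lift_le M M y {z} A).trans
        (D.lift_mono (Subgroup.commutator_le_self M) y (Finset.insert_eq z A).subset))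
  have hMfin := D.finiteIndex_of_finiteIndex_lift (H := M) fun y => hlift y _ (by simp)
  rw [eq_top_iff]
  intro g _
  obtain ⟨m, hm, h⟩ := hM M hMfin g
  simpa using mul_mem hm h

theorem isProperProdense_secSubgroup (ht : IsMulTorsion Γ) {M : Subgroup Γ}
    (hM : IsProperProdense M) (x : ZMod p) : IsProperProdense (D.secSubgroup M x) :=
  ⟨D.isProdense_secSubgroup hM.prodense x,
    fun h => hM.ne_top (D.eq_top_of_secSubgroup_eq_top ht hM.prodense h)⟩

end Prime

end SpinalGroup

/-! ### Word length and descent through sections -/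

namespace SpinalGroup

variable {p : ℕ} {V Γ : Type*} [AddCommGroup V] [Module (ZMod p) V] [Group Γ]
  (D : SpinalGroup p V Γ)

/-- `D.Rep g n v` says that `g` is a product of rooted elements and of `n` directed elements
whose exponents sum to `v`. -/
inductive Rep : Γ → ℕ → V → Prop
  | a (z : ZMod p) : Rep (D.a z) 0 0
  | b (v : V) : Rep (D.b v) 1 v
  | mul {g h : Γ} {n m : ℕ} {v w : V} : Rep g n v → Rep h m w → Rep (g * h) (n + m) (v + w)

variable {D}

theorem Rep.one : D.Rep 1 0 0 := D.a_zero ▸ Rep.a 0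

theorem Rep.inv {g : Γ} {n : ℕ} {v : V} (h : D.Rep g n v) : D.Rep g⁻¹ n (-v) := by
  induction h with
  | a z => rw [← D.a_neg, neg_zero]; exact Rep.a _
  | b v => rw [← D.b_neg]; exact Rep.b _
  | mul _ _ ih₁ ih₂ => rw [mul_inv_rev, add_comm, neg_add_rev]; exact ih₂.mul ih₁

theorem Rep.mul_a {g : Γ} {n : ℕ} {v : V} (h : D.Rep g n v) (z : ZMod p) :
    D.Rep (g * D.a z) n v := by
  simpa using h.mul (Rep.a z)

variable (D)

theorem exists_rep (g : Γ) : ∃ n v, D.Rep g n v := by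
  have hg : g ∈ Subgroup.closure (Set.range D.a ∪ Set.range D.b) :=
    D.closure_eq_top ▸ Subgroup.mem_top g
  induction hg using Subgroup.closure_induction with
  | mem x hx =>
    rcases hx with ⟨z, rfl⟩ | ⟨v, rfl⟩
    · exact ⟨_, _, Rep.a z⟩
    · exact ⟨_, _, Rep.b v⟩
  | one => exact ⟨_, _, Rep.one⟩
  | mul x y _ _ hx hy =>
    obtain ⟨n, v, h⟩ := hx
    obtain ⟨m, w, h'⟩ := hy
    exact ⟨_, _, h.mul h'⟩
  | inv x _ hx =>
    obtain ⟨n, v, h⟩ := hx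
    exact ⟨_, _, h.inv⟩

theorem exists_rep_of_mem_commutator {g : Γ} (hg : g ∈ commutator Γ) : ∃ n, D.Rep g n 0 := by
  rw [commutator_eq_closure] at hg
  induction hg using Subgroup.closure_induction with
  | mem x hx =>
    obtain ⟨s, t, rfl⟩ := hx
    obtain ⟨n, v, h⟩ := D.exists_rep s
    obtain ⟨m, w, h'⟩ := D.exists_rep t
    refine ⟨n + m + n + m, ?_⟩
    have := ((h.mul h').mul h.inv).mul h'.inv
    rwa [add_assoc v w, add_comm w, add_neg_cancel_left, add_neg_cancel] at this
  | one => exact ⟨_, Rep.one⟩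
  | mul x y _ _ hx hy =>
    obtain ⟨n, h⟩ := hx
    obtain ⟨m, h'⟩ := hy
    exact ⟨n + m, by simpa using h.mul h'⟩
  | inv x _ hx =>
    obtain ⟨n, h⟩ := hx
    exact ⟨n, by simpa using h.inv⟩

section Prime

variable [hp : Fact p.Prime]

/-- Each directed factor contributes a directed factor to exactly one section and rooted ones to the
others, so lengths and exponents are distributed among the letters. The translations cancel because
coordinate sums vanish. If all the length lands at one letter, the directed factors merge into one.
-/
theorem Rep.exists_sec (ht : IsMulTorsion Γ) {g : Γ} {n : ℕ} {v : V} (h : D.Rep g n v) :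
    ∃ (m : ZMod p → ℕ) (w : ZMod p → V), (∀ x, D.Rep (D.sec g x) (m x) (w x)) ∧
      ∑ x, m x = n ∧ ∑ x, w x = v ∧ ∑ x, D.τ (D.sec g x) = 0 ∧
      ∀ x, (∀ y, y ≠ x → m y = 0) → g = D.a (D.τ g + x) * D.b v * D.a (-x) := by
  induction h with
  | a z =>
    refine ⟨0, 0, fun x => by rw [D.sec_a]; exact Rep.one, by simp, by simp,
      by simp [D.sec_a, D.τ_one], fun x _ => ?_⟩
    rw [D.b_zero, mul_one, ← D.a_add, D.τ_a, add_neg_cancel_right]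
  | b v =>
    refine ⟨Pi.single 0 1, Pi.single 0 v, fun x => ?_, by simp, by simp, ?_, fun x hx => ?_⟩
    · by_cases hx : x = 0
      · subst hx
        simpa [D.sec_b_zero] using Rep.b v
      · simpa [hx, D.sec_b _ _ hx] using Rep.a (D := D) (D.e v x)
    · rw [← D.sum_e_eq_zero ht v]
      refine Finset.sum_congr rfl fun x _ => ?_
      by_cases hx : x = 0
      · rw [hx, D.sec_b_zero, D.τ_b, D.e_zero]
      · rw [D.sec_b _ _ hx, D.τ_a]
    · have : x = 0 := by
        by_contra hx0
        simpa using hx 0 (Ne.symm hx0)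
      simp [this, D.τ_b, D.a_zero]
  | @mul g h n k v u _ _ ih₁ ih₂ =>
    obtain ⟨m, w, hr, hm, hw, hτ, hc⟩ := ih₁
    obtain ⟨m', w', hr', hm', hw', hτ', hc'⟩ := ih₂
    refine ⟨fun x => m (x + D.τ h) + m' x, fun x => w (x + D.τ h) + w' x, fun x => ?_, ?_, ?_, ?_,
      fun x hx => ?_⟩
    · rw [D.sec_mul]; exact (hr _).mul (hr' _)
    · rw [Finset.sum_add_distrib, hm', ← hm]
      exact congrArg (· + k) (Equiv.sum_comp (Equiv.addRight (D.τ h)) m)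
    · rw [Finset.sum_add_distrib, hw', ← hw]
      exact congrArg (· + u) (Equiv.sum_comp (Equiv.addRight (D.τ h)) w)
    · simp only [D.sec_mul, D.τ_mul]
      rw [Finset.sum_add_distrib, hτ', add_zero, ← hτ]
      exact Equiv.sum_comp (Equiv.addRight (D.τ h)) fun x => D.τ (D.sec g x)
    · have h2 := hc' x fun y hy => (Nat.add_eq_zero_iff.1 (hx y hy)).2
      have h1 := hc (x + D.τ h) fun y hy => by
        have := (Nat.add_eq_zero_iff.1 (hx (y - D.τ h) fun h => hy (by rw [← h]; ring))).1
        rwa [sub_add_cancel] at this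
      have h3 : D.a (-(x + D.τ h)) * D.a (D.τ h + x) = 1 := by
        rw [← D.a_add, ← D.a_zero]; congr 1; ring
      calc g * h = (D.a (D.τ g + (x + D.τ h)) * D.b v * D.a (-(x + D.τ h)))
            * (D.a (D.τ h + x) * D.b u * D.a (-x)) := by rw [← h1, ← h2]
        _ = D.a (D.τ g + (x + D.τ h)) * D.b v * (D.a (-(x + D.τ h)) * D.a (D.τ h + x))
            * D.b u * D.a (-x) := by group
        _ = _ := by
          rw [h3, mul_one, mul_assoc (D.a _) (D.b v), ← D.b_add, D.τ_mul]
          congr 3; ring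

/-- A section of `g ^ p` is a product of the sections of `g` over a full cycle of letters, which
restores the total length and exponent. -/
theorem Rep.sec_pow (ht : IsMulTorsion Γ) {g : Γ} {n : ℕ} {v : V} (h : D.Rep g n v)
    (hg : D.τ g ≠ 0) (x : ZMod p) : D.Rep (D.sec (g ^ p) x) n v ∧ D.τ (D.sec (g ^ p) x) = 0 := by
  obtain ⟨m, w, hr, hm, hw, hτ, -⟩ := h.exists_sec D ht
  have key : ∀ j : ℕ, D.Rep (D.sec (g ^ j) x) (∑ i ∈ Finset.range j, m (x + i * D.τ g))
      (∑ i ∈ Finset.range j, w (x + i * D.τ g)) ∧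
      D.τ (D.sec (g ^ j) x) = ∑ i ∈ Finset.range j, D.τ (D.sec g (x + i * D.τ g)) := by
    intro j
    induction j with
    | zero => simpa [D.sec_one, D.τ_one] using Rep.one
    | succ j ih =>
      rw [pow_succ', D.sec_mul, D.τ_pow, D.τ_mul, ih.2]
      simp only [Finset.sum_range_succ_comm]
      exact ⟨(hr _).mul ih.1, trivial⟩
  have h1 := key p
  rw [sum_range_mul m hg, sum_range_mul w hg,
    sum_range_mul (fun y => D.τ (D.sec g y)) hg, hm, hw, hτ] at h1
  exact h1

theorem Rep.exists_sec_of_lt (ht : IsMulTorsion Γ) {g : Γ} {n : ℕ} {v : V} (h : D.Rep g n v) :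
    (∃ x, g = D.a (D.τ g + x) * D.b v * D.a (-x)) ∨
    ∃ (m : ZMod p → ℕ) (w : ZMod p → V), (∀ x, D.Rep (D.sec g x) (m x) (w x)) ∧
      (∀ x, m x < n) ∧ ∑ x, w x = v := by
  obtain ⟨m, w, hr, hm, hw, -, hc⟩ := h.exists_sec D ht
  by_cases hlt : ∀ x, m x < n
  · exact Or.inr ⟨m, w, hr, hlt, hw⟩
  · push Not at hlt
    obtain ⟨x, hx⟩ := hlt
    refine Or.inl ⟨x, hc x fun y hy => ?_⟩
    have := Finset.add_le_sum (f := m) (fun i _ => Nat.zero_le _) (Finset.mem_univ x)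
      (Finset.mem_univ y) (Ne.symm hy)
    omega

theorem a_conj_mem_of_ne_zero {M : Subgroup Γ} {c : Γ} {y : ZMod p} (hy : y ≠ 0)
    (h : c⁻¹ * D.a y * c ∈ M) (z : ZMod p) : c⁻¹ * D.a z * c ∈ M := by
  have h1 : c⁻¹ * D.a z * c = (c⁻¹ * D.a y * c) ^ (z / y).val := by
    have h2 := conj_pow (i := (z / y).val) (a := c⁻¹) (b := D.a y)
    rw [inv_inv] at h2
    rw [h2, ← D.a_nsmul, nsmul_eq_mul, ZMod.natCast_zmod_val, div_mul_cancel₀ _ hy]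
  rw [h1]
  exact pow_mem h _

/-- Sections of conjugates of a directed element are conjugates of rooted elements. -/
theorem a_conj_mem_secSubgroup {M : Subgroup Γ} {v : V} (hb : D.b v ∈ M) {m : Γ} (hm : m ∈ M)
    (h : D.e v (D.τ m) ≠ 0) (z : ZMod p) :
    (D.sec m 0)⁻¹ * D.a z * D.sec m 0 ∈ D.secSubgroup M 0 := by
  refine D.a_conj_mem_of_ne_zero h ?_ z
  refine D.mem_secSubgroup.2 ⟨m⁻¹ * D.b v * m, mul_mem (mul_mem (inv_mem hm) hb) hm, ?_, ?_⟩
  · rw [D.τ_mul, D.τ_mul, D.τ_inv, D.τ_b]; ring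
  · have h1 := D.sec_inv m 0
    rw [zero_add] at h1
    rw [D.sec_mul, D.sec_mul, D.τ_b, zero_add, add_zero, h1,
      D.sec_b _ _ (D.ne_zero_of_e_ne_zero h)]

theorem b_mem_secSubgroup {M : Subgroup Γ} {v : V} (hb : D.b v ∈ M) :
    D.b v ∈ D.secSubgroup M 0 :=
  D.mem_secSubgroup.2 ⟨_, hb, D.τ_b v, D.sec_b_zero v⟩

section Nontrivial

variable [Finite V]

/-- `M` meets the coset of `b v` modulo the commutator subgroup, whose elements have words with
exponent sum zero. -/
theorem exists_mem_rep (ht : IsMulTorsion Γ) {M : Subgroup Γ} (hM : IsProdense M) (v : V) :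
    ∃ m ∈ M, ∃ n, D.Rep m n v := by
  have := D.fg
  obtain ⟨m, hm, h⟩ := hM _ (finiteIndex_commutator_of_fg_of_isMulTorsion ht) (D.b v)
  obtain ⟨n, hn⟩ := D.exists_rep_of_mem_commutator h
  refine ⟨m, hm, 1 + n, ?_⟩
  have := (Rep.b v).mul hn.inv
  rwa [neg_zero, add_zero, mul_inv_rev, inv_inv, mul_inv_cancel_left] at this

variable [Nontrivial V]

/-- Induction on length. If `g` moves the first level, a section of `g ^ p` replaces it at no cost
in length. Then either `g` is a conjugate of `b v`, or all sections are shorter and one has nonzero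
exponent. -/
theorem exists_b_mem_of_rep (ht : IsMulTorsion Γ) (n : ℕ) {M : Subgroup Γ}
    (hM : IsProperProdense M) {g : Γ} (hg : g ∈ M) {v : V} (hv : v ≠ 0) (h : D.Rep g n v) :
    ∃ M' : Subgroup Γ, IsProperProdense M' ∧ ∃ w, w ≠ 0 ∧ D.b w ∈ M' := by
  induction n using Nat.strong_induction_on generalizing M g v with
  | _ n ih =>
  have key : ∀ {M : Subgroup Γ}, IsProperProdense M → ∀ {g : Γ}, g ∈ M → D.Rep g n v →
      D.τ g = 0 → ∃ M' : Subgroup Γ, IsProperProdense M' ∧ ∃ w, w ≠ 0 ∧ D.b w ∈ M' := by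
    intro M hM g hg h h0
    rcases h.exists_sec_of_lt D ht with ⟨x, hx⟩ | ⟨m, w, hr, hlt, hw⟩
    · refine ⟨_, hM.map_conj (D.a (-x)), v, hv, mem_map_conj ?_⟩
      rw [h0, zero_add, D.a_neg] at hx
      rw [D.a_neg, inv_inv, ← hx]
      exact hg
    · obtain ⟨x, hx⟩ : ∃ x, w x ≠ 0 := by
        by_contra! h1
        exact hv (by rw [← hw]; exact Finset.sum_eq_zero fun x _ => h1 x)
      exact ih _ (hlt x) (D.isProperProdense_secSubgroup ht hM x)
        (D.sec_mem_secSubgroup hg h0 x) hx (hr x)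
  by_cases h0 : D.τ g = 0
  · exact key hM hg h h0
  · obtain ⟨h1, h2⟩ := h.sec_pow D ht h0 0
    exact key (D.isProperProdense_secSubgroup ht hM 0)
      (D.sec_mem_secSubgroup (pow_mem hg p) (by simp [D.τ_pow]) 0) h1 h2

/-- Conjugating `b v` by `c⁻¹ * a y * c` and taking the section at `0` replaces the conjugator `c`
by the quotient of its sections at `y` and `0`. If this is never shorter, the whole length of `c`
sits at `0`, and conjugation by `b w`, which commutes with `b v`, finishes. -/
theorem exists_a_mem_of_conj_mem (ht : IsMulTorsion Γ) (n : ℕ) {M : Subgroup Γ}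
    (hM : IsProperProdense M) {v : V} (hv : v ≠ 0) (hb : D.b v ∈ M) {c : Γ} {w : V}
    (hc : D.Rep c n w) (ha : ∀ z, c⁻¹ * D.a z * c ∈ M) :
    ∃ M' : Subgroup Γ, IsProperProdense M' ∧ D.b v ∈ M' ∧ ∀ z, D.a z ∈ M' := by
  induction n using Nat.strong_induction_on generalizing M c w with
  | _ n ih =>
  obtain ⟨m, w', hr, hm, -, -, hconc⟩ := hc.exists_sec D ht
  have hsec : ∀ z, D.sec (c⁻¹ * D.a z * c) 0 = (D.sec c z)⁻¹ * D.sec c 0 := by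
    intro z
    rw [D.sec_mul, D.sec_mul, D.sec_a, mul_one, D.τ_a, zero_add, add_comm, D.sec_inv]
  have hτ : ∀ z, D.τ (c⁻¹ * D.a z * c) = z := by
    intro z
    rw [D.τ_mul, D.τ_mul, D.τ_inv, D.τ_a]; ring
  by_cases hlt : ∃ y, D.e v y ≠ 0 ∧ m y + m 0 < n
  · obtain ⟨y, hy, hlt⟩ := hlt
    have h1 := D.a_conj_mem_secSubgroup hb (ha y) (by rwa [hτ])
    rw [hsec] at h1
    exact ih _ hlt (D.isProperProdense_secSubgroup ht hM 0) (D.b_mem_secSubgroup hb)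
      ((hr y).inv.mul (hr 0)) h1
  · push Not at hlt
    obtain ⟨y₁, hy₁⟩ := D.exists_e_ne_zero hv
    obtain ⟨y₂, hy₁₂, hy₂⟩ := D.exists_e_ne_zero_of_ne ht hv y₁
    have h1 := hlt y₁ hy₁
    have h2 := hlt y₂ hy₂
    have hy₁' := D.ne_zero_of_e_ne_zero hy₁
    have hy₂' := D.ne_zero_of_e_ne_zero hy₂
    have h3 : m 0 + m y₁ + m y₂ ≤ n := by
      have h := Finset.sum_le_sum_of_subset (f := m) (Finset.subset_univ {0, y₁, y₂})
      rw [hm, Finset.sum_insert (by simp [hy₁'.symm, hy₂'.symm]),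
        Finset.sum_pair hy₁₂.symm] at h
      omega
    -- Both `m y₁ + m 0` and `m y₂ + m 0` are at least `n`, while `m 0 + m y₁ + m y₂ ≤ n`; hence `m
    -- 0 = n`.
    have h4 : c = D.a (D.τ c) * D.b w := by
      have h := hconc 0 fun y hy => by
        have := Finset.add_le_sum (f := m) (fun i _ => Nat.zero_le _) (Finset.mem_univ 0)
          (Finset.mem_univ y) (Ne.symm hy)
        omega
      rwa [add_zero, neg_zero, D.a_zero, mul_one] at h
    refine ⟨_, hM.map_conj (D.b w), mem_map_conj ?_, fun z => mem_map_conj ?_⟩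
    · rw [mul_assoc, (D.b_commute v w).eq, inv_mul_cancel_left]
      exact hb
    · have h5 := ha z
      have h6 : c⁻¹ * D.a z * c = (D.b w)⁻¹ * D.a z * D.b w := by
        rw [h4, mul_inv_rev, mul_assoc (D.b w)⁻¹, ← D.a_neg, ← D.a_add, mul_assoc (D.b w)⁻¹,
          ← mul_assoc (D.a _) (D.a _), ← D.a_add, mul_assoc]
        congr 3; ring
      rwa [h6] at h5

theorem exists_a_mem_of_b_mem (ht : IsMulTorsion Γ) {M : Subgroup Γ} (hM : IsProperProdense M)
    {v : V} (hv : v ≠ 0) (hb : D.b v ∈ M) :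
    ∃ M' : Subgroup Γ, IsProperProdense M' ∧ D.b v ∈ M' ∧ ∀ z, D.a z ∈ M' := by
  obtain ⟨y, hy⟩ := D.exists_e_ne_zero hv
  obtain ⟨m, hm, rfl⟩ := D.exists_mem_τ_eq hM.prodense y
  obtain ⟨n, w, hr⟩ := D.exists_rep (D.sec m 0)
  exact D.exists_a_mem_of_conj_mem ht n (D.isProperProdense_secSubgroup ht hM 0) hv
    (D.b_mem_secSubgroup hb) hr (D.a_conj_mem_secSubgroup hb hm hy)

/-- Sections of `M` retain the rooted elements and those directed by `W`, so the descent can follow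
a section whose exponent stays outside `W`. -/
theorem exists_b_mem_of_a_mem (ht : IsMulTorsion Γ) (n : ℕ) {M : Subgroup Γ}
    (hM : IsProperProdense M) {W : AddSubgroup V} (hW : W ≠ ⊥) (ha : ∀ z, D.a z ∈ M)
    (hb : ∀ v ∈ W, D.b v ∈ M) {g : Γ} (hg : g ∈ M) {v : V} (hv : v ∉ W) (h : D.Rep g n v) :
    ∃ M' : Subgroup Γ, IsProperProdense M' ∧ (∀ z, D.a z ∈ M') ∧ (∀ v ∈ W, D.b v ∈ M') ∧
      ∃ w ∉ W, D.b w ∈ M' := by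
  induction n using Nat.strong_induction_on generalizing M g v with
  | _ n ih =>
  have h1 : D.Rep (g * D.a (-D.τ g)) n v := h.mul_a _
  have hg1 : g * D.a (-D.τ g) ∈ M := mul_mem hg (ha _)
  have h0 : D.τ (g * D.a (-D.τ g)) = 0 := by rw [D.τ_mul, D.τ_a, add_neg_cancel]
  rcases h1.exists_sec_of_lt D ht with ⟨x, hx⟩ | ⟨m, w, hr, hlt, hw⟩
  · refine ⟨M, hM, ha, hb, v, hv, ?_⟩
    have h2 : D.b v = D.a (-x) * (g * D.a (-D.τ g)) * D.a x := by
      rw [hx, h0, zero_add, D.a_neg]; group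
    rw [h2]
    exact mul_mem (mul_mem (ha _) hg1) (ha _)
  · obtain ⟨x, hx⟩ : ∃ x, w x ∉ W := by
      by_contra! h2
      exact hv (by rw [← hw]; exact sum_mem fun x _ => h2 x)
    refine ih _ (hlt x) (D.isProperProdense_secSubgroup ht hM x) (fun z => ?_) (fun u hu => ?_)
      (D.sec_mem_secSubgroup hg1 h0 x) hx (hr x)
    · obtain ⟨u, hu, hu0⟩ := W.bot_or_exists_ne_zero.resolve_left hW
      obtain ⟨y, hy⟩ := D.exists_e_ne_zero hu0
      have h2 : D.a (D.e u y) ∈ D.secSubgroup M x := by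
        refine D.mem_secSubgroup.2 ⟨D.a (x - y) * D.b u * D.a (-(x - y)),
          mul_mem (mul_mem (ha _) (hb u hu)) (ha _), by rw [D.a_neg, D.τ_conj, D.τ_b], ?_⟩
        rw [D.sec_conj_a, sub_sub_cancel, D.sec_b _ _ (D.ne_zero_of_e_ne_zero hy)]
      simpa using D.a_conj_mem_of_ne_zero (c := 1) hy (by simpa using h2) z
    · refine D.mem_secSubgroup.2 ⟨D.a x * D.b u * D.a (-x),
        mul_mem (mul_mem (ha _) (hb u hu)) (ha _), by rw [D.a_neg, D.τ_conj, D.τ_b], ?_⟩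
      rw [D.sec_conj_a, sub_self, D.sec_b_zero]

theorem not_isProperProdense_of_a_mem (ht : IsMulTorsion Γ) (W : AddSubgroup V) (hW : W ≠ ⊥)
    (M : Subgroup Γ) (ha : ∀ z, D.a z ∈ M) (hb : ∀ v ∈ W, D.b v ∈ M) : ¬IsProperProdense M := by
  induction W using WellFoundedGT.induction generalizing M with
  | ind W ih =>
  intro hM
  by_cases hWtop : W = ⊤
  · refine hM.ne_top (eq_top_iff.2 ?_)
    rw [← D.closure_eq_top, Subgroup.closure_le]
    rintro _ (⟨z, rfl⟩ | ⟨v, rfl⟩)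
    · exact ha z
    · exact hb v (hWtop ▸ AddSubgroup.mem_top v)
  · obtain ⟨v, hv⟩ : ∃ v, v ∉ W := by
      by_contra! h
      exact hWtop (eq_top_iff.2 fun v _ => h v)
    obtain ⟨g, hg, n, hr⟩ := D.exists_mem_rep ht hM.prodense v
    obtain ⟨M', hM', ha', hb', w, hw, hbw⟩ := D.exists_b_mem_of_a_mem ht n hM hW ha hb hg hv hr
    -- All directed elements now available; this strictly enlarges `W`, which can happen only
    -- finitely often.
    let W' : AddSubgroup V :=
      { carrier := {u | D.b u ∈ M'}
        add_mem' := fun {u u'} hu hu' => by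
          rw [Set.mem_ofPred_eq, D.b_add]; exact mul_mem hu hu'
        zero_mem' := by rw [Set.mem_ofPred_eq, D.b_zero]; exact one_mem _
        neg_mem' := fun {u} hu => by rw [Set.mem_ofPred_eq, D.b_neg]; exact inv_mem hu }
    have hlt : W < W' := lt_of_le_of_ne hb' fun h => hw (h ▸ hbw)
    exact ih W' hlt (fun h => hW (eq_bot_iff.2 (h ▸ hlt.le))) M' ha' (fun _ hu => hu) hM'

theorem not_isProperProdense (D : SpinalGroup p V Γ) (ht : IsMulTorsion Γ) (M : Subgroup Γ) :
    ¬IsProperProdense M := by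
  intro hM
  obtain ⟨v, hv⟩ := exists_ne (0 : V)
  obtain ⟨g, hg, n, hr⟩ := D.exists_mem_rep ht hM.prodense v
  obtain ⟨M₁, hM₁, w, hw, hb₁⟩ := D.exists_b_mem_of_rep ht n hM hg hv hr
  obtain ⟨M₂, hM₂, hb₂, ha₂⟩ := D.exists_a_mem_of_b_mem ht hM₁ hw hb₁
  refine D.not_isProperProdense_of_a_mem ht (AddSubgroup.zmultiples w)
    (by simpa using hw) M₂ ha₂ ?_ hM₂
  rintro _ ⟨k, rfl⟩
  have h1 : D.b (((k : ZMod p).val) • w) ∈ M₂ := by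
    rw [D.b_nsmul]; exact pow_mem hb₂ _
  rwa [← Nat.cast_smul_eq_nsmul (ZMod p), ZMod.natCast_zmod_val, Int.cast_smul_eq_zsmul] at h1

end Nontrivial

end Prime

end SpinalGroup

/-! ### Rooted and directed tree automorphisms -/

section TreeAut

variable {X : Type*}

theorem TreeAut.ext {g h : TreeAut X}
    (H : ∀ w, (g : Equiv.Perm (List X)) w = (h : Equiv.Perm (List X)) w) : g = h :=
  Subtype.ext (Equiv.ext H)

theorem TreeAut.apply_nil (g : TreeAut X) : (g : Equiv.Perm (List X)) [] = [] := by
  have h := (g.2 [] ((g : Equiv.Perm (List X))⁻¹ [])).2 List.nil_prefix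
  rw [show (g : Equiv.Perm (List X)) ((g : Equiv.Perm (List X))⁻¹ []) = [] from
    Equiv.apply_symm_apply _ _] at h
  exact List.prefix_nil.1 h

theorem rooted_mul (σ τ : Equiv.Perm X) : rooted σ * rooted τ = rooted (σ * τ) :=
  TreeAut.ext fun w => by cases w <;> rfl

theorem rooted_addRight_mul [AddCommGroup X] (z w : X) :
    rooted (Equiv.addRight z) * rooted (Equiv.addRight w) = rooted (Equiv.addRight (z + w)) := by
  rw [rooted_mul]
  congr 1
  ext x
  simp [add_assoc, add_comm w]

theorem genA_pow (p n : ℕ) : genA p ^ n = rooted (Equiv.addRight (n : ZMod p)) := by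
  induction n with
  | zero => exact TreeAut.ext fun w => by cases w <;> simp [rooted, rootedFun]
  | succ n ih =>
    rw [pow_succ, ih, genA, rooted_addRight_mul, Nat.cast_succ]

variable [DecidableEq X]

theorem directed_mul (o : X) (c d : {x : X // x ≠ o} → TreeAut X) :
    directed o c * directed o d = directed o (c * d) := by
  refine TreeAut.ext fun w => ?_
  change directedFun o c (directedFun o d w) = directedFun o (c * d) w
  induction w with
  | nil => rfl
  | cons x w ih =>
    by_cases h : x = o
    · simp [directedFun, h, ih]
    · simp [directedFun, h]

end TreeAut

/-! ### The multi-edge spinal group as an abstract spinal group -/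

section Concrete

variable {p r : ℕ} (E : Fin r → {x : ZMod p // x ≠ 0} → ZMod p)

/-- The linear combinations of the defining vectors, extended by zero. -/
def exponents : (Fin r → ZMod p) →ₗ[ZMod p] (ZMod p → ZMod p) where
  toFun v x := if h : x = 0 then 0 else ∑ i, v i * E i ⟨x, h⟩
  map_add' v w := by
    ext x
    by_cases h : x = 0
    · simp [h]
    · simp [h, add_mul, Finset.sum_add_distrib]
  map_smul' k v := by
    ext x
    by_cases h : x = 0
    · simp [h]
    · simp [h, mul_assoc, Finset.mul_sum]

theorem exponents_zero (v : Fin r → ZMod p) : exponents E v 0 = 0 := by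
  simp [exponents]

theorem exponents_injective (hE : LinearIndependent (ZMod p) E) :
    Function.Injective (exponents E) := by
  refine (injective_iff_map_eq_zero _).2 fun v hv => funext fun i => ?_
  refine Fintype.linearIndependent_iff.1 hE v (funext fun x => ?_) i
  have := congrFun hv x
  simpa [exponents, x.2] using this

/-- The directed automorphism with the given exponents. -/
def directedElt (v : Fin r → ZMod p) : TreeAut (ZMod p) :=
  directed 0 fun x => rooted (Equiv.addRight (exponents E v x))

theorem directedElt_add (v w : Fin r → ZMod p) :
    directedElt E (v + w) = directedElt E v * directedElt E w := by
  rw [directedElt, directedElt, directedElt, directed_mul]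
  congr 1
  ext1 x
  rw [Pi.mul_apply, rooted_addRight_mul, map_add, Pi.add_apply]

theorem directedElt_single [NeZero p] (i : Fin r) :
    directedElt E (Pi.single i 1) = genB p (E i) := by
  rw [directedElt, genB]
  congr 1
  ext1 x
  rw [genA_pow, ZMod.natCast_zmod_val]
  congr 2
  simp [exponents, x.2, Pi.single_apply]

theorem directedElt_mem [NeZero p] (v : Fin r → ZMod p) :
    directedElt E v ∈ multiEdgeSpinalGroup p E := by
  have hadd : ∀ v w, directedElt E v ∈ multiEdgeSpinalGroup p E →
      directedElt E w ∈ multiEdgeSpinalGroup p E →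
      directedElt E (v + w) ∈ multiEdgeSpinalGroup p E := fun v w hv hw => by
    rw [directedElt_add]; exact mul_mem hv hw
  have hzero : directedElt E 0 ∈ multiEdgeSpinalGroup p E := by
    have h := directedElt_add E 0 0
    rw [add_zero] at h
    rw [left_eq_mul.1 h]
    exact one_mem _
  let S : AddSubmonoid (Fin r → ZMod p) :=
    { carrier := {v | directedElt E v ∈ multiEdgeSpinalGroup p E}
      add_mem' := fun {v w} => hadd v w
      zero_mem' := hzero }
  have hsum : v = ∑ i, (v i).val • (Pi.single i 1 : Fin r → ZMod p) := by
    ext j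
    rw [Finset.sum_apply]
    simp [-ZMod.natCast_val, Pi.single_apply, ZMod.natCast_zmod_val]
  change v ∈ S
  rw [hsum]
  refine sum_mem fun i _ => nsmul_mem ?_ _
  change directedElt E _ ∈ multiEdgeSpinalGroup p E
  rw [directedElt_single]
  exact Subgroup.subset_closure (Or.inr ⟨i, rfl⟩)

theorem rooted_mem [NeZero p] (z : ZMod p) :
    rooted (Equiv.addRight z) ∈ multiEdgeSpinalGroup p E := by
  rw [← ZMod.natCast_zmod_val z, ← genA_pow]
  have h : genA p ∈ multiEdgeSpinalGroup p E := Subgroup.subset_closure (Or.inl rfl)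
  exact pow_mem h _

theorem directedElt_zero_cons (v : Fin r → ZMod p) (w : List (ZMod p)) :
    (directedElt E v : Equiv.Perm (List (ZMod p))) (0 :: w)
      = 0 :: (directedElt E v : Equiv.Perm (List (ZMod p))) w := by
  change directedFun _ _ _ = _
  rw [directedFun, dif_pos rfl]
  rfl

theorem directedElt_cons (v : Fin r → ZMod p) {x : ZMod p} (hx : x ≠ 0) (w : List (ZMod p)) :
    (directedElt E v : Equiv.Perm (List (ZMod p))) (x :: w)
      = x :: (rooted (Equiv.addRight (exponents E v x)) : Equiv.Perm (List (ZMod p))) w := by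
  change directedFun _ _ _ = _
  rw [directedFun, dif_neg hx]

/-- Self-similarity of the multi-edge spinal group. -/
theorem exists_sections [NeZero p] (g : TreeAut (ZMod p)) (hg : g ∈ multiEdgeSpinalGroup p E) :
    ∃ t : ZMod p, ∀ x, ∃ h ∈ multiEdgeSpinalGroup p E, ∀ w,
      (g : Equiv.Perm (List (ZMod p))) (x :: w)
        = (x + t) :: (h : Equiv.Perm (List (ZMod p))) w := by
  induction hg using Subgroup.closure_induction with
  | mem g hg =>
    rcases hg with rfl | ⟨i, rfl⟩
    · exact ⟨1, fun x => ⟨1, one_mem _, fun w => rfl⟩⟩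
    · refine ⟨0, fun x => ?_⟩
      beta_reduce
      rw [← directedElt_single, add_zero]
      by_cases hx : x = 0
      · subst hx
        exact ⟨_, directedElt_mem E _, directedElt_zero_cons E _⟩
      · exact ⟨_, rooted_mem E _, directedElt_cons E _ hx⟩
  | one => exact ⟨0, fun x => ⟨1, one_mem _, fun w => by simp⟩⟩
  | mul g k _ _ ihg ihk =>
    obtain ⟨t, ht⟩ := ihg
    obtain ⟨u, hu⟩ := ihk
    refine ⟨u + t, fun x => ?_⟩
    obtain ⟨k', hk', hk⟩ := hu x
    obtain ⟨g', hg', hg⟩ := ht (x + u)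
    refine ⟨g' * k', mul_mem hg' hk', fun w => ?_⟩
    rw [Subgroup.coe_mul, Subgroup.coe_mul, Equiv.Perm.mul_apply, Equiv.Perm.mul_apply, hk, hg,
      add_assoc]
  | inv g _ ihg =>
    obtain ⟨t, ht⟩ := ihg
    refine ⟨-t, fun x => ?_⟩
    obtain ⟨h, hh, hg⟩ := ht (x + -t)
    refine ⟨h⁻¹, inv_mem hh, fun w => ?_⟩
    rw [Subgroup.coe_inv, Subgroup.coe_inv, Equiv.Perm.inv_eq_iff_eq, hg,
      neg_add_cancel_right]
    exact congrArg _ (Equiv.apply_symm_apply _ _).symm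

/-- The action of the multi-edge spinal group on words. -/
def act (g : multiEdgeSpinalGroup p E) : List (ZMod p) → List (ZMod p) :=
  ((g : TreeAut (ZMod p)) : Equiv.Perm (List (ZMod p)))

theorem act_injective {g h : multiEdgeSpinalGroup p E} (H : ∀ w, act E g w = act E h w) : g = h :=
  Subtype.ext (TreeAut.ext H)

theorem act_mul (g h : multiEdgeSpinalGroup p E) (w : List (ZMod p)) :
    act E (g * h) w = act E g (act E h w) := rfl

theorem exists_translation_section [NeZero p] (g : multiEdgeSpinalGroup p E) :
    ∃ (t : ZMod p) (s : ZMod p → multiEdgeSpinalGroup p E),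
      ∀ x w, act E g (x :: w) = (x + t) :: act E (s x) w := by
  obtain ⟨t, ht⟩ := exists_sections E g g.2
  choose s hs hs' using ht
  exact ⟨t, fun x => ⟨s x, hs x⟩, hs'⟩

/-- The translation induced on the first level. -/
noncomputable def translation [NeZero p] (g : multiEdgeSpinalGroup p E) : ZMod p :=
  (exists_translation_section E g).choose

/-- The section at a letter. -/
noncomputable def sect [NeZero p] (g : multiEdgeSpinalGroup p E) :
    ZMod p → multiEdgeSpinalGroup p E :=
  (exists_translation_section E g).choose_spec.choose

theorem act_cons [NeZero p] (g : multiEdgeSpinalGroup p E) (x : ZMod p) (w : List (ZMod p)) :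
    act E g (x :: w) = (x + translation E g) :: act E (sect E g x) w :=
  (exists_translation_section E g).choose_spec.choose_spec x w

theorem translation_eq [NeZero p] {g : multiEdgeSpinalGroup p E} {t x : ZMod p}
    {h : multiEdgeSpinalGroup p E} (H : ∀ w, act E g (x :: w) = (x + t) :: act E h w) :
    translation E g = t ∧ sect E g x = h := by
  have key := fun w => (act_cons E g x w).symm.trans (H w)
  exact ⟨add_left_cancel (List.cons.inj (key [])).1,
    act_injective E fun w => (List.cons.inj (key w)).2⟩

/-- The multi-edge spinal group as an abstract spinal group. -/
noncomputable def spinalGroup [NeZero p] (hE : LinearIndependent (ZMod p) E) :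
    SpinalGroup p (Fin r → ZMod p) (multiEdgeSpinalGroup p E) :=
  have hmul : ∀ (g h : multiEdgeSpinalGroup p E) (x : ZMod p),
      translation E (g * h) = translation E g + translation E h ∧
        sect E (g * h) x = sect E g (x + translation E h) * sect E h x := fun g h x =>
    translation_eq E fun w => by
      rw [act_mul, act_cons, act_cons, act_mul, add_assoc, add_comm (translation E h)]
  have ha : ∀ z x : ZMod p, translation E ⟨_, rooted_mem E z⟩ = z ∧
      sect E ⟨_, rooted_mem E z⟩ x = 1 := fun z x => translation_eq E fun w => rfl
  have hb0 : ∀ v, translation E ⟨_, directedElt_mem E v⟩ = 0 ∧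
      sect E ⟨_, directedElt_mem E v⟩ 0 = ⟨_, directedElt_mem E v⟩ := fun v =>
    translation_eq E fun w => by rw [add_zero]; exact directedElt_zero_cons E v w
  { a := fun z => ⟨_, rooted_mem E z⟩
    b := fun v => ⟨_, directedElt_mem E v⟩
    e := exponents E
    τ := translation E
    sec := sect E
    a_add := fun z w => Subtype.ext <| by
      rw [Subgroup.coe_mul, rooted_addRight_mul]
    b_add := fun v w => Subtype.ext (directedElt_add E v w)
    e_zero := exponents_zero E
    e_injective := exponents_injective E hE
    τ_mul := fun g h => (hmul g h 0).1
    τ_a := fun z => (ha z 0).1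
    τ_b := fun v => (hb0 v).1
    sec_mul := fun g h x => (hmul g h x).2
    sec_a := fun z x => (ha z x).2
    sec_b_zero := fun v => (hb0 v).2
    sec_b := fun v x hx => (translation_eq E (t := 0) fun w => by
      rw [add_zero]; exact directedElt_cons E v hx w).2
    closure_eq_top := by
      refine eq_top_iff.2 (Subgroup.closure_closure_coe_preimage.ge.trans
        (Subgroup.closure_mono ?_))
      rintro ⟨g, hg'⟩ (hg | ⟨i, hg⟩)
      · refine Or.inl ⟨1, Subtype.ext ?_⟩
        exact (hg : g = genA p).symm
      · exact Or.inr ⟨Pi.single i 1, Subtype.ext ((directedElt_single E i).trans hg)⟩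
    faithful := by
      intro T hT g hg
      refine act_injective E fun w => ?_
      induction w generalizing g with
      | nil => exact TreeAut.apply_nil _
      -- Elements of `T` fix the first letter and have sections in `T`, so induction on words
      -- applies to all of `T` at once.
      | cons x w ih =>
        obtain ⟨h0, h1⟩ := hT g hg
        rw [act_cons, h0, ih _ (h1 x), add_zero]
        rfl }

end Concrete

/-! ### Maximal subgroups -/

section Maximal

variable {Γ : Type*} [Group Γ] {p : ℕ} [Fact p.Prime]

theorem isSimpleGroup_quotient_of_isCoatom {M : Subgroup Γ} [M.Normal] (hM : IsCoatom M) :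
    IsSimpleGroup (Γ ⧸ M) := by
  have hnt : Nontrivial (Γ ⧸ M) := QuotientGroup.nontrivial_iff.2 hM.1
  refine ⟨fun N _ => ?_⟩
  have hle : M ≤ N.comap (QuotientGroup.mk' M) := by
    have := MonoidHom.ker_le_comap (QuotientGroup.mk' M) N
    rwa [QuotientGroup.ker_mk'] at this
  have hsurj := QuotientGroup.mk'_surjective M
  rcases hM.le_iff.1 hle with h | h
  · exact Or.inr (Subgroup.comap_injective hsurj (h.trans (Subgroup.comap_top _).symm))
  · refine Or.inl (Subgroup.comap_injective hsurj (h.trans ?_))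
    rw [MonoidHom.comap_bot, QuotientGroup.ker_mk']

/-- Modulo its core, `M` is maximal in a finite `p`-group, hence normal by nilpotency. The quotient
by `M` is then simple and solvable, so abelian. -/
theorem commutator_le_of_isCoatom_of_finiteIndex (hΓ : IsPGroup p Γ) {M : Subgroup Γ}
    (hM : IsCoatom M) [hfin : M.FiniteIndex] : commutator Γ ≤ M := by
  have hcore := M.finiteIndex_normalCore
  have hnorm : M.Normal := by
    set N := M.normalCore
    have hN : N ≤ M := M.normalCore_le
    have := (hΓ.to_quotient N).isNilpotent
    have hsurj := QuotientGroup.mk'_surjective N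
    have hker : (QuotientGroup.mk' N).ker ≤ M := by rwa [QuotientGroup.ker_mk']
    have hcomap : (M.map (QuotientGroup.mk' N)).comap (QuotientGroup.mk' N) = M :=
      Subgroup.comap_map_eq_self hker
    have hco : IsCoatom (M.map (QuotientGroup.mk' N)) := by
      refine ⟨fun h => hM.1 ?_, fun K hK => ?_⟩
      · rw [← hcomap, h, Subgroup.comap_top]
      · refine Subgroup.comap_injective hsurj ?_
        rw [Subgroup.comap_top]
        refine hM.2 _ (hcomap.symm.trans_lt ?_)
        exact (Subgroup.comap_lt_comap_of_surjective hsurj).2 hK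
    have := Subgroup.NormalizerCondition.normal_of_coatom _
      Group.normalizerCondition_of_isNilpotent hco
    rw [← hcomap]
    infer_instance
  have := isSimpleGroup_quotient_of_isCoatom hM
  have := (hΓ.to_quotient M).isNilpotent
  rw [← Subgroup.Normal.quotient_commutative_iff_commutator_le]
  exact ⟨⟨IsSimpleGroup.comm_iff_isSolvable.2 inferInstance⟩⟩

theorem index_eq_of_isCoatom (hΓ : IsPGroup p Γ) {M : Subgroup Γ} (hM : IsCoatom M)
    [hfin : M.FiniteIndex] (h : commutator Γ ≤ M) : M.Normal ∧ M.index = p := by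
  have hn : M.Normal := Subgroup.Normal.of_commutator_le _ h
  refine ⟨hn, ?_⟩
  have := isSimpleGroup_quotient_of_isCoatom hM
  have hcomm := Subgroup.Normal.quotient_commutative_iff_commutator_le.2 h
  let _ : CommGroup (Γ ⧸ M) := { (inferInstance : Group (Γ ⧸ M)) with mul_comm := hcomm.1.1 }
  have hprime : (Nat.card (Γ ⧸ M)).Prime := IsSimpleGroup.prime_card
  obtain ⟨n, hn⟩ := IsPGroup.iff_card.1 (hΓ.to_quotient M)
  rw [hn] at hprime
  rw [Subgroup.index, hn, hprime.eq_one_of_pow, pow_one]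

theorem SpinalGroup.normal_and_index_eq {V : Type*} [AddCommGroup V] [Module (ZMod p) V]
    [Nontrivial V] [Finite V] (D : SpinalGroup p V Γ) (ht : IsMulTorsion Γ) {M : Subgroup Γ}
    (hM : IsCoatom M) : M.Normal ∧ M.index = p := by
  have hpg := D.isPGroup ht
  have := D.fg
  by_cases hfin : M.FiniteIndex
  · exact index_eq_of_isCoatom hpg hM (commutator_le_of_isCoatom_of_finiteIndex hpg hM)
  refine absurd ⟨fun N hN g => ?_, hM.1⟩ (D.not_isProperProdense ht M)
  have hcore := N.finiteIndex_normalCore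
  -- Otherwise maximality would put the core of `N` inside `M`, giving `M` finite index.
  have htop : M ⊔ N.normalCore = ⊤ := by
    rcases hM.le_iff.1 (le_sup_left : M ≤ M ⊔ N.normalCore) with h | h
    · exact h
    · exact absurd (Subgroup.finiteIndex_of_le (sup_eq_left.1 h)) hfin
  obtain ⟨m, hm, n, hn, rfl⟩ := Subgroup.mem_sup_of_normal_right.1 (htop ▸ Subgroup.mem_top g)
  exact ⟨m, hm, by rw [inv_mul_cancel_left]; exact N.normalCore_le hn⟩

end Maximal

end MultiEdgeSpinal

theorem theorem1p1 (p : ℕ) [Fact p.Prime] (hp : Odd p) (r : ℕ) (hr : 1 ≤ r)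
    (E : Fin r → {x : ZMod p // x ≠ 0} → ZMod p) (hE : LinearIndependent (ZMod p) E)
    (hG : IsMulTorsion (MultiEdgeSpinal.multiEdgeSpinalGroup p E)) :
    (∀ M : Subgroup (MultiEdgeSpinal.multiEdgeSpinalGroup p E),
      IsCoatom M → M.Normal ∧ M.index = p) ∧
    ¬ ∃ M : Subgroup (MultiEdgeSpinal.multiEdgeSpinalGroup p E),
      IsCoatom M ∧ ¬ M.FiniteIndex := by
  have : NeZero r := ⟨by omega⟩
  have key := fun M (hM : IsCoatom M) =>
    (MultiEdgeSpinal.spinalGroup E hE).normal_and_index_eq hG (M := M) hM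
  refine ⟨key, ?_⟩
  rintro ⟨M, hM, hM'⟩
  refine hM' ⟨?_⟩
  rw [(key M hM).2]
  exact NeZero.ne p
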